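/- Let $B$ be a unital algebra over $\mathbb{C}$. A $B$-$B$-non-commutative probability space $(\mathcal A,E,\varepsilon)$ is a unital algebra $\mathcal A$ with a unital homomorphism $\varepsilon:B\otimes B^{\mathrm{op}}\to\mathcal A$ and a linear map $E:\mathcal A\to B$ such that, with $L_b=\varepsilon(b\otimes 1)$ and $R_b=\varepsilon(1\otimes b)$, the maps $b\mapsto L_b$ and $b\mapsto R_b$ are injective, $E(L_{b_1}R_{b_2}T)=b_1E(T)b_2$ and $E(TL_b)=E(TR_b)$. Let $\mathcal A_\ell$ (resp. $\mathcal A_r$) be the set of elements commuting with all $R_b$ (resp. all $L_b$). A pair of $B$-faces is a pair $(C,D)$ of unital subalgebras with $L_B\subseteq C\subseteq\mathcal A_\ell$ and $R_B\subseteq D\subseteq\mathcal A_r$. A family $\{(C_k,D_k)\}_{k\in K}$ of pairs of $B$-faces is bi-free over $B$ if there are $B$-$B$-bimodules with specified $B$-projections $\mathcal X_k=B\oplus\mathcal X_k^\circ$ and unital homomorphisms from $C_k$ (resp. $D_k$) to the algebra of linear operators on $\mathcal X_k$ commuting with right (resp. left) multiplication by $B$, such that the joint distribution of the family equals that of its image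 under the left (for $C_k$) and right (for $D_k$) regular representations on the reduced free product of the $\mathcal X_k$ with amalgamation over $B$. For each $k\in K$ let $(A_k^\ell,A_k^r)$ be a pair of $B$-faces, $C_k,D_k\subseteq\mathcal A$ subalgebras, and $C_k'\subseteq C_k$, $D_k'\subseteq D_k\cap\mathcal A_\ell$ subsets with $L_bC_k'\subseteq C_k'$ and $C_k'L_b\subseteq C_k'$ for all $b\in B$, such that $\{(\mathrm{alg}(A_k^\ell,C_k),\mathrm{alg}(A_k^r,D_k))\}_{k\in K}$ is a bi-free family of pairs of $B$-faces. Put $\mathbb A_k=\mathrm{alg}(A_k^\ell,A_k^r)$. The family $\{(A_k^\ell,A_k^r,C_k',D_k')\}_{k\in K}$ is a *bi-free ffb $B$-system* if for all $m\ge 0$ and $k\in K$, with elementwise products of sets, 1. every element of $C_k'\mathbb A_kC_k'$ and of $D_k'\mathbb A_kD_k'$ is $0$; 2. $E$ vanishes on $\mathbb A_kC_k'\mathbb A_k(D_k'\mathbb A_kC_k')^m\mathbb A_k$; 3. $E$ vanishes on $\mathbb A_kD_k'\mathbb A_k(C_k'\mathbb A_kD_k')^m\mathbb A_k$. Given $\hat\chi:\{1,\dots,n'\}\to\{\ell,r,b\}$,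 put $n=n'+|\hat\chi^{-1}(b)|$ and $f(j)=j+|\hat\chi^{-1}(b)\cap[1,j-1]|$. The $\ell$-$r$-replacement $\chi:\{1,\dots,n\}\to\{\ell,r\}$ of $\hat\chi$ is $\chi(f(j))=\hat\chi(j)$ if $\hat\chi(j)\ne b$, $\chi(f(j))=\ell$ if $\hat\chi(j)=b$, and $\chi(i)=r$ for $i$ outside the range of $f$. A partition $\pi$ of $\{1,\dots,n\}$ is in $BNC(\chi)$ if it is non-crossing for the order $\prec_\chi$ that lists $\chi^{-1}(\ell)$ increasingly and then $\chi^{-1}(r)$ decreasingly; it is in $BNC_{\mathrm{ffb}}(\hat\chi)$ if moreover $f(j)$ and $f(j)+1$ lie in the same block of $\pi$ whenever $\hat\chi(j)=b$. For $\pi\in BNC(\chi)$, $E_\pi(Z_1,\dots,Z_n)\in B$ is defined recursively. If $\pi$ has a single block, it is $E(Z_1\cdots Z_n)$. Otherwise let $V$ be the block with the largest minimum and $\beta=E(\prod_{i\in V}Z_i)$ (increasing order of indices). If $V=\{k+1,\dots,n\}$, remove $V$ and replace $Z_k$ by $Z_kL_\beta$; else let $W$ be the block whose spine (vertical line) in the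 bi-non-crossing diagram of $\pi$ is adjacent to the node $\min V$, let $k$ be the smallest element of $W$ larger than $\min V$, remove $V$, and replace $Z_k$ by $L_\beta Z_k$ if $\chi(\min V)=\ell$ and by $R_\beta Z_k$ if $\chi(\min V)=r$. Then $E_\pi(Z_1,\dots,Z_n)$ is the value for the remaining partition and the remaining entries (relabelled increasingly). **Theorem.** Let $\{(A_k^\ell,A_k^r,C_k',D_k')\}_{k\in K}$ be a bi-free ffb $B$-system in $(\mathcal A,E,\varepsilon)$, let $\hat\chi:\{1,\dots,n'\}\to\{\ell,r,b\}$ with $\ell$-$r$-replacement $\chi:\{1,\dots,n\}\to\{\ell,r\}$, and let $\epsilon:\{1,\dots,n\}\to K$ satisfy $\epsilon(f(j))=\epsilon(f(j)+1)$ whenever $\hat\chi(j)=b$. Let $Z_{f(j)}\in A^{\hat\chi(j)}_{\epsilon(f(j))}$ if $\hat\chi(j)\in\{\ell,r\}$, $Z_{f(j)}\in C'_{\epsilon(f(j))}$ if $\hat\chi(j)=b$, and $Z_i\in D'_{\epsilon(i)}$ for $i$ outside the range of $f$. If $\pi\in BNC(\chi)$ and $\epsilon$ is constant on every block of $\pi$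 (that is, $\pi\le\epsilon$), then $$E_\pi(Z_1,\dots,Z_n)=0\quad\text{unless}\quad \pi\in BNC_{\mathrm{ffb}}(\hat\chi).$$ -/

import Mathlib

open MulOpposite
open scoped TensorProduct Pointwise

universe u v w x

namespace BiFree

/-- A `B`-`B`-bimodule over a unital complex algebra `B`: a complex vector space with commuting
left and right `B`-actions (the right one written as an action of `Bᵐᵒᵖ`). -/
structure Bimod (B : Type u) [Ring B] [Algebra ℂ B] where
  carrier : Type x
  [addCommGroup : AddCommGroup carrier]
  [module : Module ℂ carrier]
  [leftModule : Module B carrier]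
  [rightModule : Module Bᵐᵒᵖ carrier]
  [smulComm : SMulCommClass B Bᵐᵒᵖ carrier]
  [leftTower : IsScalarTower ℂ B carrier]
  [rightTower : IsScalarTower ℂ Bᵐᵒᵖ carrier]

attribute [instance] Bimod.addCommGroup Bimod.module Bimod.leftModule Bimod.rightModule
  Bimod.smulComm Bimod.leftTower Bimod.rightTower

section Space

variable {B : Type u} [Ring B] [Algebra ℂ B]

/-- The `B`-`B`-bimodule with specified `B`-projection `B ⊕ X°`. It is determined by `X°`, and the
specified projection is `(b, η) ↦ b`. -/
abbrev Bimod.Full (X : Bimod.{u, x} B) : Type (max u x) := B × X.carrier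

/-- Left multiplication `L_b` by `b` on `B ⊕ X°`. -/
def Bimod.L (X : Bimod.{u, x} B) (b : B) : Module.End ℂ X.Full where
  toFun ξ := (b * ξ.1, b • ξ.2)
  map_add' ξ η := by simp [mul_add]
  map_smul' z ξ := by
    ext
    · simp
    · exact smul_comm b z ξ.2

/-- Right multiplication `R_b` by `b` on `B ⊕ X°`. -/
def Bimod.R (X : Bimod.{u, x} B) (b : B) : Module.End ℂ X.Full where
  toFun ξ := (ξ.1 * b, op b • ξ.2)
  map_add' ξ η := by simp [add_mul]
  map_smul' z ξ := by
    ext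
    · simp
    · exact smul_comm (op b) z ξ.2

/-- The left algebra `𝓛_ℓ(B ⊕ X°)`: the operators that commute with all right multiplications. -/
def Bimod.leftOps (X : Bimod.{u, x} B) : Subalgebra ℂ (Module.End ℂ X.Full) :=
  Subalgebra.centralizer ℂ (Set.range X.R)

/-- The right algebra `𝓛_r(B ⊕ X°)`: the operators that commute with all left multiplications. -/
def Bimod.rightOps (X : Bimod.{u, x} B) : Subalgebra ℂ (Module.End ℂ X.Full) :=
  Subalgebra.centralizer ℂ (Set.range X.L)

end Space

/-! ### The reduced free product with amalgamation over `B` -/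

section FreeProduct

variable {B : Type u} [Ring B] [Algebra ℂ B] {K : Type w} (X : K → Bimod.{u, x} B)

/-- Generators of the reduced free product: elements of `B` and of the spaces `X°_k`. -/
abbrev Gen : Type (max u w x) := B ⊕ (Σ k, (X k).carrier)

variable {X} in
/-- The element `b ∈ B` as a generator. -/
def gB (b : B) : FreeAlgebra ℂ (Gen X) := FreeAlgebra.ι ℂ (Sum.inl b)

variable {X} in
/-- The element `η ∈ X°_k` as a generator. -/
def gX (k : K) (η : (X k).carrier) : FreeAlgebra ℂ (Gen X) := FreeAlgebra.ι ℂ (Sum.inr ⟨k, η⟩)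

/-- The relations of the reduced free product. All but the last one present the tensor algebra
`⨁_{n ≥ 0} M ⊗_B ⋯ ⊗_B M` of the bimodule `M = ⨁_k X°_k` over `B`; the last one kills every tensor
word in which two neighbouring letters come from the same `X°_k`. -/
inductive FPRel : FreeAlgebra ℂ (Gen X) → FreeAlgebra ℂ (Gen X) → Prop
  | b_one : FPRel (gB 1) 1
  | b_mul (b b' : B) : FPRel (gB (b * b')) (gB b * gB b')
  | b_add (b b' : B) : FPRel (gB (b + b')) (gB b + gB b')
  | b_smul (z : ℂ) (b : B) : FPRel (gB (z • b)) (z • gB b)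
  | x_add (k : K) (η η' : (X k).carrier) : FPRel (gX k (η + η')) (gX k η + gX k η')
  | x_smul (k : K) (z : ℂ) (η : (X k).carrier) : FPRel (gX k (z • η)) (z • gX k η)
  | left (k : K) (b : B) (η : (X k).carrier) : FPRel (gX k (b • η)) (gB b * gX k η)
  | right (k : K) (b : B) (η : (X k).carrier) : FPRel (gX k (op b • η)) (gX k η * gB b)
  | same (k : K) (η η' : (X k).carrier) : FPRel (gX k η * gX k η') 0

/-- The reduced free product with amalgamation over `B`,
`B ⊕ ⨁_{n ≥ 1} ⨁_{k₁ ≠ k₂ ≠ ⋯ ≠ kₙ} X°_{k₁} ⊗_B ⋯ ⊗_B X°_{kₙ}`,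
realised as the quotient of the tensor algebra over `B` of `⨁_k X°_k` by the non-alternating words.
The tensor `η₁ ⊗ ⋯ ⊗ ηₙ` is the product `incX k₁ η₁ * ⋯ * incX kₙ ηₙ`, and the bimodule structure is
multiplication by `incB b` on either side. -/
abbrev FreeProd : Type (max u w x) := RingQuot (FPRel X)

/-- The inclusion of `B`. -/
def incB : B →ₐ[ℂ] FreeProd X :=
  AlgHom.ofLinearMap
    { toFun := fun b => RingQuot.mkAlgHom ℂ (FPRel X) (gB b)
      map_add' := fun b b' => by
        rw [RingQuot.mkAlgHom_rel ℂ (FPRel.b_add b b'), map_add]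
      map_smul' := fun z b => by
        rw [RingQuot.mkAlgHom_rel ℂ (FPRel.b_smul z b), map_smul]; rfl }
    (by
      change RingQuot.mkAlgHom ℂ (FPRel X) (gB 1) = 1
      rw [RingQuot.mkAlgHom_rel ℂ FPRel.b_one, map_one])
    (fun b b' => by
      change RingQuot.mkAlgHom ℂ (FPRel X) (gB (b * b')) = _
      rw [RingQuot.mkAlgHom_rel ℂ (FPRel.b_mul b b'), map_mul]; rfl)

/-- The inclusion of `X°_k`. -/
def incX (k : K) : (X k).carrier →ₗ[ℂ] FreeProd X where
  toFun η := RingQuot.mkAlgHom ℂ (FPRel X) (gX k η)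
  map_add' η η' := by
    rw [RingQuot.mkAlgHom_rel ℂ (FPRel.x_add k η η'), map_add]
  map_smul' z η := by
    rw [RingQuot.mkAlgHom_rel ℂ (FPRel.x_smul k z η), map_smul]; rfl

variable {X}

theorem incX_left (k : K) (b : B) (η : (X k).carrier) :
    incX X k (b • η) = incB X b * incX X k η := by
  change RingQuot.mkAlgHom ℂ (FPRel X) (gX k (b • η)) = _
  rw [RingQuot.mkAlgHom_rel ℂ (FPRel.left k b η), map_mul]; rfl

theorem incX_right (k : K) (b : B) (η : (X k).carrier) :
    incX X k (op b • η) = incX X k η * incB X b := by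
  change RingQuot.mkAlgHom ℂ (FPRel X) (gX k (op b • η)) = _
  rw [RingQuot.mkAlgHom_rel ℂ (FPRel.right k b η), map_mul]; rfl

theorem incX_same (k : K) (η η' : (X k).carrier) : incX X k η * incX X k η' = 0 := by
  change RingQuot.mkAlgHom ℂ (FPRel X) (gX k η) * RingQuot.mkAlgHom ℂ (FPRel X) (gX k η') = 0
  rw [← map_mul, RingQuot.mkAlgHom_rel ℂ (FPRel.same k η η'), map_zero]

theorem freeProd_induction {C : FreeProd X → Prop} (hB : ∀ b, C (incB X b))
    (hX : ∀ k η, C (incX X k η)) (hadd : ∀ p q, C p → C q → C (p + q))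
    (hmul : ∀ p q, C p → C q → C (p * q)) (q : FreeProd X) : C q := by
  obtain ⟨a, rfl⟩ := RingQuot.mkAlgHom_surjective ℂ (FPRel X) q
  induction a using FreeAlgebra.induction with
  | grade0 z =>
    rw [AlgHom.commutes]
    have h := hB (algebraMap ℂ B z)
    rwa [AlgHom.commutes] at h
  | grade1 g =>
    rcases g with b | ⟨k, η⟩
    · exact hB b
    · exact hX k η
  | mul a b ha hb => rw [map_mul]; exact hmul _ _ ha hb
  | add a b ha hb => rw [map_add]; exact hadd _ _ ha hb

/-- Algebra homomorphisms out of the underlying quotient algebra. -/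
theorem exists_lift {S : Type*} [Ring S] [Algebra ℂ S] (f : B → S) (g : ∀ k, (X k).carrier → S)
    (h1 : f 1 = 1) (hm : ∀ b b', f (b * b') = f b * f b') (ha : ∀ b b', f (b + b') = f b + f b')
    (hs : ∀ (z : ℂ) b, f (z • b) = z • f b) (ga : ∀ k η η', g k (η + η') = g k η + g k η')
    (gs : ∀ k (z : ℂ) η, g k (z • η) = z • g k η) (gl : ∀ k (b : B) η, g k (b • η) = f b * g k η)
    (gr : ∀ k (b : B) η, g k (op b • η) = g k η * f b) (g0 : ∀ k η η', g k η * g k η' = 0) :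
    ∃ φ : FreeProd X →ₐ[ℂ] S, (∀ b, φ (incB X b) = f b) ∧ ∀ k η, φ (incX X k η) = g k η := by
  let F : FreeAlgebra ℂ (Gen X) →ₐ[ℂ] S :=
    FreeAlgebra.lift ℂ (Sum.elim f fun s => g s.1 s.2)
  have hB : ∀ b, F (gB b) = f b := fun b => by simp [F, gB]
  have hX : ∀ k η, F (gX k η) = g k η := fun k η => by simp [F, gX]
  have hF : ∀ ⦃p q⦄, FPRel X p q → F p = F q := by
    intro p q h
    cases h <;> simp only [map_mul, map_add, map_smul, map_one, map_zero, *]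
  refine ⟨RingQuot.liftAlgHom ℂ ⟨F, hF⟩, fun b => ?_, fun k η => ?_⟩
  · exact (RingQuot.liftAlgHom_mkAlgHom_apply ℂ F hF (gB b)).trans (hB b)
  · exact (RingQuot.liftAlgHom_mkAlgHom_apply ℂ F hF (gX k η)).trans (hX k η)

variable (X)

theorem exists_proj : ∃ φ : FreeProd X →ₐ[ℂ] B,
    (∀ b, φ (incB X b) = b) ∧ ∀ k η, φ (incX X k η) = 0 :=
  exists_lift (fun b => b) (fun _ _ => 0) rfl (fun _ _ => rfl) (fun _ _ => rfl) (fun _ _ => rfl)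
    (by simp) (by simp) (by simp) (by simp) (by simp)

/-- The specified `B`-projection of the reduced free product: it is the identity on `B` and
vanishes on all tensor words of positive length. -/
noncomputable def proj : FreeProd X →ₐ[ℂ] B := (exists_proj X).choose

theorem proj_incB (b : B) : proj X (incB X b) = b := (exists_proj X).choose_spec.1 b

theorem proj_incX (k : K) (η : (X k).carrier) : proj X (incX X k η) = 0 :=
  (exists_proj X).choose_spec.2 k η

/-- The expectation `T ↦ p (T 1_B)` on linear maps of the reduced free product. -/
noncomputable def freeProdE (T : Module.End ℂ (FreeProd X)) : B := proj X (T (incB X 1))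

/-- The embedding of `B ⊕ X°_k` into the reduced free product. -/
def inc (k : K) : (X k).Full →ₗ[ℂ] FreeProd X := (incB X).toLinearMap.coprod (incX X k)

/-- The subspace `𝒳_ℓ(k)` spanned by `B` and the words that do not start with a letter of `X°_k`. -/
def notStart (k : K) : Submodule ℂ (FreeProd X) :=
  Submodule.span ℂ (Set.range (incB X) ∪
    {q | ∃ (j : K) (η : (X j).carrier) (p : FreeProd X), j ≠ k ∧ q = incX X j η * p})

/-- The subspace `𝒳_r(k)` spanned by `B` and the words that do not end with a letter of `X°_k`. -/
def notEnd (k : K) : Submodule ℂ (FreeProd X) :=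
  Submodule.span ℂ (Set.range (incB X) ∪
    {q | ∃ (j : K) (η : (X j).carrier) (p : FreeProd X), j ≠ k ∧ q = p * incX X j η})

variable {X}

theorem inc_apply (k : K) (ξ : (X k).Full) : inc X k ξ = incB X ξ.1 + incX X k ξ.2 := rfl

theorem inc_R (k : K) (ξ : (X k).Full) (b : B) :
    inc X k ((X k).R b ξ) = inc X k ξ * incB X b := by
  simp [inc_apply, Bimod.R, incX_right, add_mul]

theorem inc_L (k : K) (ξ : (X k).Full) (b : B) :
    inc X k ((X k).L b ξ) = incB X b * inc X k ξ := by
  simp [inc_apply, Bimod.L, incX_left, mul_add]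

theorem exists_foxRight {N : Type*} [AddCommGroup N] [Module ℂ N] [Module (FreeProd X)ᵐᵒᵖ N]
    [IsScalarTower ℂ (FreeProd X)ᵐᵒᵖ N] (g : ∀ k, (X k).carrier →ₗ[ℂ] N)
    (hg : ∀ k η (b : B), g k (op b • η) = op (incB X b) • g k η)
    (h0 : ∀ k η η', op (incX X k η') • g k η = 0) :
    ∃ D : FreeProd X →ₗ[ℂ] N, (∀ b, D (incB X b) = 0) ∧
      ∀ k η q, D (incX X k η * q) = op q • g k η := by
  have hc : ∀ (z : ℂ) (q : FreeProd X) (n : N), op q • z • n = z • op q • n := fun z q n =>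
    smul_comm _ _ _
  let f : B → (Module.End ℂ (B × N))ᵐᵒᵖ := fun b => op
    { toFun := fun s => (s.1 * b, op (incB X b) • s.2)
      map_add' := fun s t => by simp [add_mul]
      map_smul' := fun z s => by simp [hc] }
  let h : ∀ k, (X k).carrier → (Module.End ℂ (B × N))ᵐᵒᵖ := fun k η => op
    { toFun := fun s => (0, op (incX X k η) • s.2 + g k (s.1 • η))
      map_add' := fun s t => by simp [add_smul]; abel
      map_smul' := fun z s => by simp [hc] }
  obtain ⟨φ, hφB, hφX⟩ := exists_lift (X := X) f h
    (by apply unop_injective; ext s <;> simp [f])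
    (fun b b' => by apply unop_injective; ext s <;> simp [f, mul_smul, mul_assoc])
    (fun b b' => by apply unop_injective; ext s <;> simp [f, mul_add, add_smul])
    (fun z b => by apply unop_injective; ext s <;> simp [f])
    (fun k η η' => by apply unop_injective; ext s <;> simp [h, add_smul])
    (fun k z η => by apply unop_injective; ext s <;> simp [h, smul_comm _ z])
    (fun k b η => by
      apply unop_injective; ext s <;> simp [f, h, incX_left, mul_smul])
    (fun k b η => by
      apply unop_injective; ext s <;> simp [f, h, incX_right, mul_smul, smul_comm _ (op b), hg])
    (fun k η η' => by
      apply unop_injective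
      ext s
      · simp [h]
      · simp [h, h0]
      · simp [h]
      · simp [h, ← mul_smul, ← op_mul, incX_same])
  have key : ∀ (q : FreeProd X) (n : N), unop (φ q) (0, n) = (0, op q • n) := by
    intro q
    induction q using freeProd_induction with
    | hB b => intro n; simp [hφB, f]
    | hX k η => intro n; simp [hφX, h]
    | hadd p q hp hq => intro n; simp [hp, hq, add_smul]
    | hmul p q hp hq => intro n; simp [hp, hq, mul_smul]
  refine ⟨LinearMap.snd ℂ B N ∘ₗ (LinearMap.applyₗ ((1 : B), (0 : N))) ∘ₗ
    (opLinearEquiv ℂ).symm.toLinearMap ∘ₗ φ.toLinearMap, fun b => ?_, fun k η q => ?_⟩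
  · simp [hφB, f]
  · have : unop (φ (incX X k η)) (1, 0) = (0, g k η) := by simp [hφX, h]
    simp [this, key]

set_option maxHeartbeats 1000000 in
theorem exists_foxLeft {N : Type*} [AddCommGroup N] [Module ℂ N] [Module (FreeProd X) N]
    [IsScalarTower ℂ (FreeProd X) N] (g : ∀ k, (X k).carrier →ₗ[ℂ] N)
    (hg : ∀ k η (b : B), g k (b • η) = incB X b • g k η)
    (h0 : ∀ k η η', incX X k η' • g k η = 0) :
    ∃ D : FreeProd X →ₗ[ℂ] N, (∀ b, D (incB X b) = 0) ∧
      ∀ k η q, D (q * incX X k η) = q • g k η := by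
  have hc : ∀ (z : ℂ) (q : FreeProd X) (n : N), q • z • n = z • q • n := fun z q n =>
    smul_comm _ _ _
  let f : B → Module.End ℂ (B × N) := fun b =>
    { toFun := fun s => (b * s.1, incB X b • s.2)
      map_add' := fun s t => by simp [mul_add]
      map_smul' := fun z s => by simp [hc] }
  let h : ∀ k, (X k).carrier → Module.End ℂ (B × N) := fun k η =>
    { toFun := fun s => (0, incX X k η • s.2 + g k (op s.1 • η))
      map_add' := fun s t => by simp [add_smul]; abel
      map_smul' := fun z s => by simp [hc] }
  obtain ⟨φ, hφB, hφX⟩ := exists_lift (X := X) f h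
    (by ext s <;> simp [f])
    (fun b b' => by ext s <;> simp [f, mul_smul, mul_assoc])
    (fun b b' => by ext s <;> simp [f, add_mul, add_smul])
    (fun z b => by ext s <;> simp [f])
    (fun k η η' => by ext s <;> simp [h, add_smul])
    (fun k z η => by ext s <;> simp [h, smul_comm _ z])
    (fun k b η => by
      ext s
      · simp [f, h]
      · simp [f, h, ← hg, smul_comm b (op s) η]
      · simp [f, h]
      · simp [f, h, incX_left, mul_smul])
    (fun k b η => by
      ext s <;> simp [f, h, incX_right, mul_smul])
    (fun k η η' => by
      ext s
      · simp [h]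
      · simp [h, h0]
      · simp [h]
      · simp [h, ← mul_smul, incX_same])
  have key : ∀ (q : FreeProd X) (n : N), φ q (0, n) = (0, q • n) := by
    intro q
    induction q using freeProd_induction with
    | hB b => intro n; simp [hφB, f]
    | hX k η => intro n; simp [hφX, h]
    | hadd p q hp hq => intro n; simp [hp, hq, add_smul]
    | hmul p q hp hq => intro n; simp [hp, hq, mul_smul]
  refine ⟨LinearMap.snd ℂ B N ∘ₗ (LinearMap.applyₗ ((1 : B), (0 : N))) ∘ₗ
    φ.toLinearMap, fun b => ?_, fun k η q => ?_⟩
  · simp [hφB, f]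
  · have : φ (incX X k η) (1, 0) = (0, g k η) := by simp [hφX, h]
    simp [this, key]

theorem incB_mem_notStart (k : K) (b : B) : incB X b ∈ notStart X k :=
  Submodule.subset_span (Or.inl ⟨b, rfl⟩)

theorem incX_mul_mem_notStart {j k : K} (h : j ≠ k) (η : (X j).carrier) (q : FreeProd X) :
    incX X j η * q ∈ notStart X k :=
  Submodule.subset_span (Or.inr ⟨j, η, q, h, rfl⟩)

theorem incB_mem_notEnd (k : K) (b : B) : incB X b ∈ notEnd X k :=
  Submodule.subset_span (Or.inl ⟨b, rfl⟩)

theorem mul_incX_mem_notEnd {j k : K} (h : j ≠ k) (η : (X j).carrier) (q : FreeProd X) :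
    q * incX X j η ∈ notEnd X k :=
  Submodule.subset_span (Or.inr ⟨j, η, q, h, rfl⟩)

theorem incB_mul_mem_notStart {k : K} (b : B) {q : FreeProd X} (hq : q ∈ notStart X k) :
    incB X b * q ∈ notStart X k := by
  induction hq using Submodule.span_induction with
  | mem q hq =>
    rcases hq with ⟨c, rfl⟩ | ⟨j, η, p, hj, rfl⟩
    · rw [← map_mul]; exact incB_mem_notStart k _
    · rw [← mul_assoc, ← incX_left]; exact incX_mul_mem_notStart hj _ _
  | zero => simp
  | add p q _ _ hp hq => rw [mul_add]; exact add_mem hp hq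
  | smul z q _ hq => rw [mul_smul_comm]; exact Submodule.smul_mem _ _ hq

theorem mul_incB_mem_notEnd {k : K} (b : B) {q : FreeProd X} (hq : q ∈ notEnd X k) :
    q * incB X b ∈ notEnd X k := by
  induction hq using Submodule.span_induction with
  | mem q hq =>
    rcases hq with ⟨c, rfl⟩ | ⟨j, η, p, hj, rfl⟩
    · rw [← map_mul]; exact incB_mem_notEnd k _
    · rw [mul_assoc, ← incX_right]; exact mul_incX_mem_notEnd hj _ _
  | zero => simp
  | add p q _ _ hp hq => rw [add_mul]; exact add_mem hp hq
  | smul z q _ hq => rw [smul_mul_assoc]; exact Submodule.smul_mem _ _ hq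

/-- The vectors `V_k⁻¹ (ξ ⊗ q)` span the reduced free product. -/
theorem span_start (k : K) :
    Submodule.span ℂ {p | ∃ ξ : (X k).Full, ∃ q ∈ notStart X k, p = inc X k ξ * q} = ⊤ := by
  set S := Submodule.span ℂ {p | ∃ ξ : (X k).Full, ∃ q ∈ notStart X k, p = inc X k ξ * q}
  have hN : ∀ q ∈ notStart X k, q ∈ S := fun q hq =>
    Submodule.subset_span ⟨(1, 0), q, hq, by simp [inc_apply]⟩
  have hS : ∀ p q : FreeProd X, q ∈ S → p * q ∈ S := by
    intro p
    induction p using freeProd_induction with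
    | hB b =>
      intro q hq
      induction hq using Submodule.span_induction with
      | mem q hq =>
        obtain ⟨ξ, r, hr, rfl⟩ := hq
        exact Submodule.subset_span ⟨(X k).L b ξ, r, hr, by rw [inc_L, mul_assoc]⟩
      | zero => simp
      | add p q _ _ hp hq => rw [mul_add]; exact add_mem hp hq
      | smul z q _ hq => rw [mul_smul_comm]; exact Submodule.smul_mem _ _ hq
    | hX j η =>
      intro q hq
      by_cases hj : j = k
      · subst hj
        induction hq using Submodule.span_induction with
        | mem q hq =>
          obtain ⟨ξ, r, hr, rfl⟩ := hq
          refine Submodule.subset_span ⟨(0, op ξ.1 • η), r, hr, ?_⟩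
          simp [inc_apply, incX_right, ← mul_assoc, mul_add, incX_same]
        | zero => simp
        | add p q _ _ hp hq => rw [mul_add]; exact add_mem hp hq
        | smul z q _ hq => rw [mul_smul_comm]; exact Submodule.smul_mem _ _ hq
      · exact hN _ (incX_mul_mem_notStart hj _ _)
    | hadd p p' hp hp' => intro q hq; rw [add_mul]; exact add_mem (hp q hq) (hp' q hq)
    | hmul p p' hp hp' => intro q hq; rw [mul_assoc]; exact hp _ (hp' q hq)
  refine eq_top_iff.2 fun q _ => ?_
  have h1 : (1 : FreeProd X) ∈ S := hN _ (by simpa using incB_mem_notStart (X := X) k 1)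
  simpa using hS q 1 h1

/-- The vectors `W_k⁻¹ (q ⊗ ξ)` span the reduced free product. -/
theorem span_end (k : K) :
    Submodule.span ℂ {p | ∃ ξ : (X k).Full, ∃ q ∈ notEnd X k, p = q * inc X k ξ} = ⊤ := by
  set S := Submodule.span ℂ {p | ∃ ξ : (X k).Full, ∃ q ∈ notEnd X k, p = q * inc X k ξ}
  have hN : ∀ q ∈ notEnd X k, q ∈ S := fun q hq =>
    Submodule.subset_span ⟨(1, 0), q, hq, by simp [inc_apply]⟩
  have hS : ∀ p q : FreeProd X, q ∈ S → q * p ∈ S := by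
    intro p
    induction p using freeProd_induction with
    | hB b =>
      intro q hq
      induction hq using Submodule.span_induction with
      | mem q hq =>
        obtain ⟨ξ, r, hr, rfl⟩ := hq
        exact Submodule.subset_span ⟨(X k).R b ξ, r, hr, by rw [inc_R, mul_assoc]⟩
      | zero => simp
      | add p q _ _ hp hq => rw [add_mul]; exact add_mem hp hq
      | smul z q _ hq => rw [smul_mul_assoc]; exact Submodule.smul_mem _ _ hq
    | hX j η =>
      intro q hq
      by_cases hj : j = k
      · subst hj
        induction hq using Submodule.span_induction with
        | mem q hq =>
          obtain ⟨ξ, r, hr, rfl⟩ := hq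
          refine Submodule.subset_span ⟨(0, ξ.1 • η), r, hr, ?_⟩
          simp [inc_apply, incX_left, mul_assoc, add_mul, incX_same]
        | zero => simp
        | add p q _ _ hp hq => rw [add_mul]; exact add_mem hp hq
        | smul z q _ hq => rw [smul_mul_assoc]; exact Submodule.smul_mem _ _ hq
      · exact hN _ (mul_incX_mem_notEnd hj _ _)
    | hadd p p' hp hp' => intro q hq; rw [mul_add]; exact add_mem (hp q hq) (hp' q hq)
    | hmul p p' hp hp' => intro q hq; rw [← mul_assoc]; exact hp' _ (hp q hq)
  refine eq_top_iff.2 fun q _ => ?_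
  have h1 : (1 : FreeProd X) ∈ S := hN _ (by simpa using incB_mem_notEnd (X := X) k 1)
  simpa using hS q 1 h1

open Classical in
/-- Existence and uniqueness of `V_k⁻¹ (T ⊗ Id) V_k` for `T ∈ 𝓛_ℓ(𝒳_k)`. -/
theorem existsUnique_leftRep (k : K) (T : (X k).leftOps) :
    ∃! Λ : Module.End ℂ (FreeProd X), ∀ ξ : (X k).Full, ∀ q ∈ notStart X k,
      Λ (inc X k ξ * q) = inc X k ((T : Module.End ℂ (X k).Full) ξ) * q := by
  obtain ⟨T, hT⟩ := T
  have hT' : ∀ (b : B) ξ, T ((X k).R b ξ) = (X k).R b (T ξ) := fun b ξ =>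
    (LinearMap.congr_fun (Subalgebra.mem_centralizer_iff ℂ |>.1 hT _ ⟨b, rfl⟩) ξ).symm
  refine existsUnique_of_exists_of_unique ?_ ?_
  swap
  · intro Λ Λ' h h'
    refine LinearMap.ext_on (span_start k) ?_
    rintro _ ⟨ξ, q, hq, rfl⟩
    rw [h ξ q hq, h' ξ q hq]
  -- projection onto the words that start with a letter of `X°_k`
  obtain ⟨P, hPB, hPX⟩ := exists_foxRight (X := X) (N := FreeProd X) (Pi.single k (incX X k))
    (by
      intro j η b
      by_cases hj : j = k
      · subst hj; simp [incX_right]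
      · simp [Pi.single_eq_of_ne hj])
    (by
      intro j η η'
      by_cases hj : j = k
      · subst hj; simp [incX_same]
      · simp [Pi.single_eq_of_ne hj])
  let I : Submodule (FreeProd X)ᵐᵒᵖ (FreeProd X) :=
    Submodule.span (FreeProd X)ᵐᵒᵖ (Set.range (incX X k))
  have hI : ∀ q ∈ I, q - P q = 0 := by
    suffices h : ∀ q ∈ I, ∀ r, q * r - P (q * r) = 0 by
      intro q hq; simpa using h q hq 1
    intro q hq
    induction hq using Submodule.span_induction with
    | mem q hq =>
      obtain ⟨η, rfl⟩ := hq
      intro r; rw [hPX]; simp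
    | zero => simp
    | add p q _ _ hp hq =>
      intro r
      have := congrArg₂ (· + ·) (hp r) (hq r)
      simp only [add_mul, map_add] at this ⊢
      rw [← add_zero (0 : FreeProd X), ← this]; abel
    | smul a q _ hq =>
      intro r
      have := hq (unop a * r)
      rwa [← mul_assoc] at this
  let Q : (FreeProd X ⧸ I) →ₗ[ℂ] FreeProd X :=
    (I.restrictScalars ℂ).liftQ (LinearMap.id - P) (fun q hq => by
      simpa using hI q hq)
  have hQ : ∀ q, Q (Submodule.Quotient.mk q) = q - P q := fun q => rfl
  have hTη : ∀ (b : B) (η : (X k).carrier),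
      T (0, op b • η) = ((T (0, η)).1 * b, op b • (T (0, η)).2) := fun b η => by
    have := hT' b (0, η)
    simpa [Bimod.R] using this
  obtain ⟨D₁, hD₁B, hD₁X⟩ := exists_foxRight (X := X) (N := FreeProd X)
    (Pi.single k (incX X k ∘ₗ LinearMap.snd ℂ _ _ ∘ₗ T ∘ₗ LinearMap.inr ℂ _ _))
    (by
      intro j η b
      by_cases hj : j = k
      · subst hj; simp [hTη, incX_right]
      · simp [Pi.single_eq_of_ne hj])
    (by
      intro j η η'
      by_cases hj : j = k
      · subst hj; simp [incX_same]
      · simp [Pi.single_eq_of_ne hj])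
  obtain ⟨D₂, hD₂B, hD₂X⟩ := exists_foxRight (X := X) (N := FreeProd X ⧸ I)
    (Pi.single k ((I.mkQ.restrictScalars ℂ) ∘ₗ (incB X).toLinearMap ∘ₗ LinearMap.fst ℂ _ _ ∘ₗ T ∘ₗ
      LinearMap.inr ℂ _ _))
    (by
      intro j η b
      by_cases hj : j = k
      · subst hj
        simp [hTη, ← Submodule.Quotient.mk_smul]
      · simp [Pi.single_eq_of_ne hj])
    (by
      intro j η η'
      by_cases hj : j = k
      · subst hj
        simp only [Pi.single_eq_same, LinearMap.comp_apply, LinearMap.restrictScalars_apply,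
          Submodule.mkQ_apply, ← Submodule.Quotient.mk_smul]
        rw [Submodule.Quotient.mk_eq_zero]
        refine Submodule.subset_span ⟨(T (0, η)).1 • η', ?_⟩
        simp [incX_left]
      · simp [Pi.single_eq_of_ne hj])
  have hP0 : ∀ q ∈ notStart X k, P q = 0 ∧ D₁ q = 0 ∧ D₂ q = 0 := by
    intro q hq
    induction hq using Submodule.span_induction with
    | mem q hq =>
      rcases hq with ⟨b, rfl⟩ | ⟨j, η, p, hj, rfl⟩
      · exact ⟨hPB b, hD₁B b, hD₂B b⟩
      · simp [hPX, hD₁X, hD₂X, Pi.single_eq_of_ne hj]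
    | zero => simp
    | add p q _ _ hp hq => simp [hp.1, hp.2.1, hp.2.2, hq.1, hq.2.1, hq.2.2]
    | smul z q _ hq => simp [hq.1, hq.2.1, hq.2.2]
  refine ⟨LinearMap.mulLeft ℂ (inc X k (T (1, 0))) ∘ₗ (LinearMap.id - P) + D₁ + Q ∘ₗ D₂,
    fun ξ q hq => ?_⟩
  have hξ : T ξ = (X k).R ξ.1 (T (1, 0)) + T (0, ξ.2) := by
    rw [← hT', ← map_add]
    congr 1
    ext <;> simp [Bimod.R]
  have hbq := hP0 _ (incB_mul_mem_notStart ξ.1 hq)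
  have hpq := hP0 _ (incB_mul_mem_notStart (T (0, ξ.2)).1 hq)
  rw [hξ, map_add, inc_R]
  simp only [inc_apply k ξ, add_mul, map_add, LinearMap.add_apply, LinearMap.comp_apply, hD₁X, hD₂X,
    LinearMap.sub_apply, LinearMap.id_apply, hPX, hbq.1, hbq.2.1, hbq.2.2, map_zero,
    Pi.single_eq_same, LinearMap.restrictScalars_apply, Submodule.mkQ_apply,
    ← Submodule.Quotient.mk_smul, hQ]
  simp only [AlgHom.toLinearMap_apply, op_smul_eq_mul, LinearMap.mulLeft_apply,
    LinearMap.fst_apply, LinearMap.snd_apply, LinearMap.inr_apply, hpq.1, inc_apply k (T (0, ξ.2)),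
    add_mul, mul_assoc]
  simp
  abel
open Classical in
/-- Existence and uniqueness of `W_k⁻¹ (Id ⊗ T) W_k` for `T ∈ 𝓛_r(𝒳_k)`. -/
theorem existsUnique_rightRep (k : K) (T : (X k).rightOps) :
    ∃! Λ : Module.End ℂ (FreeProd X), ∀ ξ : (X k).Full, ∀ q ∈ notEnd X k,
      Λ (q * inc X k ξ) = q * inc X k ((T : Module.End ℂ (X k).Full) ξ) := by
  obtain ⟨T, hT⟩ := T
  have hT' : ∀ (b : B) ξ, T ((X k).L b ξ) = (X k).L b (T ξ) := fun b ξ =>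
    (LinearMap.congr_fun (Subalgebra.mem_centralizer_iff ℂ |>.1 hT _ ⟨b, rfl⟩) ξ).symm
  refine existsUnique_of_exists_of_unique ?_ ?_
  swap
  · intro Λ Λ' h h'
    refine LinearMap.ext_on (span_end k) ?_
    rintro _ ⟨ξ, q, hq, rfl⟩
    rw [h ξ q hq, h' ξ q hq]
  -- projection onto the words that end with a letter of `X°_k`
  obtain ⟨P, hPB, hPX⟩ := exists_foxLeft (X := X) (N := FreeProd X) (Pi.single k (incX X k))
    (by
      intro j η b
      by_cases hj : j = k
      · subst hj; simp [incX_left]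
      · simp [Pi.single_eq_of_ne hj])
    (by
      intro j η η'
      by_cases hj : j = k
      · subst hj; simp [incX_same]
      · simp [Pi.single_eq_of_ne hj])
  let I : Submodule (FreeProd X) (FreeProd X) :=
    Submodule.span (FreeProd X) (Set.range (incX X k))
  have hI : ∀ q ∈ I, q - P q = 0 := by
    suffices h : ∀ q ∈ I, ∀ r, r * q - P (r * q) = 0 by
      intro q hq; simpa using h q hq 1
    intro q hq
    induction hq using Submodule.span_induction with
    | mem q hq =>
      obtain ⟨η, rfl⟩ := hq
      intro r; rw [hPX]; simp
    | zero => simp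
    | add p q _ _ hp hq =>
      intro r
      have := congrArg₂ (· + ·) (hp r) (hq r)
      simp only [mul_add, map_add] at this ⊢
      rw [← add_zero (0 : FreeProd X), ← this]; abel
    | smul a q _ hq =>
      intro r
      have := hq (r * a)
      rwa [mul_assoc] at this
  let Q : (FreeProd X ⧸ I) →ₗ[ℂ] FreeProd X :=
    (I.restrictScalars ℂ).liftQ (LinearMap.id - P) (fun q hq => by
      simpa using hI q hq)
  have hQ : ∀ q, Q (Submodule.Quotient.mk q) = q - P q := fun q => rfl
  have hTη : ∀ (b : B) (η : (X k).carrier),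
      T (0, b • η) = (b * (T (0, η)).1, b • (T (0, η)).2) := fun b η => by
    have := hT' b (0, η)
    simpa [Bimod.L] using this
  obtain ⟨D₁, hD₁B, hD₁X⟩ := exists_foxLeft (X := X) (N := FreeProd X)
    (Pi.single k (incX X k ∘ₗ LinearMap.snd ℂ _ _ ∘ₗ T ∘ₗ LinearMap.inr ℂ _ _))
    (by
      intro j η b
      by_cases hj : j = k
      · subst hj; simp [hTη, incX_left]
      · simp [Pi.single_eq_of_ne hj])
    (by
      intro j η η'
      by_cases hj : j = k
      · subst hj; simp [incX_same]
      · simp [Pi.single_eq_of_ne hj])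
  obtain ⟨D₂, hD₂B, hD₂X⟩ := exists_foxLeft (X := X) (N := FreeProd X ⧸ I)
    (Pi.single k ((I.mkQ.restrictScalars ℂ) ∘ₗ (incB X).toLinearMap ∘ₗ LinearMap.fst ℂ _ _ ∘ₗ T ∘ₗ
      LinearMap.inr ℂ _ _))
    (by
      intro j η b
      by_cases hj : j = k
      · subst hj
        simp [hTη, ← Submodule.Quotient.mk_smul]
      · simp [Pi.single_eq_of_ne hj])
    (by
      intro j η η'
      by_cases hj : j = k
      · subst hj
        simp only [Pi.single_eq_same, LinearMap.comp_apply, LinearMap.restrictScalars_apply,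
          Submodule.mkQ_apply, ← Submodule.Quotient.mk_smul]
        rw [Submodule.Quotient.mk_eq_zero]
        refine Submodule.subset_span ⟨op (T (0, η)).1 • η', ?_⟩
        simp [incX_right]
      · simp [Pi.single_eq_of_ne hj])
  have hP0 : ∀ q ∈ notEnd X k, P q = 0 ∧ D₁ q = 0 ∧ D₂ q = 0 := by
    intro q hq
    induction hq using Submodule.span_induction with
    | mem q hq =>
      rcases hq with ⟨b, rfl⟩ | ⟨j, η, p, hj, rfl⟩
      · exact ⟨hPB b, hD₁B b, hD₂B b⟩
      · simp [hPX, hD₁X, hD₂X, Pi.single_eq_of_ne hj]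
    | zero => simp
    | add p q _ _ hp hq => simp [hp.1, hp.2.1, hp.2.2, hq.1, hq.2.1, hq.2.2]
    | smul z q _ hq =>
      exact ⟨by rw [map_smul, hq.1, smul_zero], by rw [map_smul, hq.2.1, smul_zero],
        by rw [map_smul, hq.2.2]; exact smul_zero (A := FreeProd X ⧸ I) z⟩
  refine ⟨LinearMap.mulRight ℂ (inc X k (T (1, 0))) ∘ₗ (LinearMap.id - P) + D₁ + Q ∘ₗ D₂,
    fun ξ q hq => ?_⟩
  have hξ : T ξ = (X k).L ξ.1 (T (1, 0)) + T (0, ξ.2) := by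
    rw [← hT', ← map_add]
    congr 1
    ext <;> simp [Bimod.L]
  have hbq := hP0 _ (mul_incB_mem_notEnd ξ.1 hq)
  have hpq := hP0 _ (mul_incB_mem_notEnd (T (0, ξ.2)).1 hq)
  rw [hξ, map_add, inc_L]
  simp only [inc_apply k ξ, mul_add, map_add, LinearMap.add_apply, LinearMap.comp_apply, hD₁X, hD₂X,
    LinearMap.sub_apply, LinearMap.id_apply, hPX, hbq.1, hbq.2.1, hbq.2.2, map_zero,
    Pi.single_eq_same, LinearMap.restrictScalars_apply, Submodule.mkQ_apply,
    ← Submodule.Quotient.mk_smul, hQ]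
  simp only [AlgHom.toLinearMap_apply, smul_eq_mul, LinearMap.mulRight_apply,
    LinearMap.fst_apply, LinearMap.snd_apply, LinearMap.inr_apply, hpq.1, inc_apply k (T (0, ξ.2)),
    mul_add, ← mul_assoc]
  simp
  abel

/-- The left regular representation `λ_k(T) = V_k⁻¹ (T ⊗ Id) V_k` of `T ∈ 𝓛_ℓ(𝒳_k)`, where
`V_k⁻¹ : 𝒳_k ⊗_B 𝒳_ℓ(k) → 𝒳` is `ξ ⊗ q ↦ inc X k ξ * q`: it is the unique operator that maps
`V_k⁻¹ (ξ ⊗ q)` to `V_k⁻¹ (T ξ ⊗ q)`. -/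
noncomputable def leftRep (k : K) (T : (X k).leftOps) : Module.End ℂ (FreeProd X) :=
  (existsUnique_leftRep k T).choose

/-- The right regular representation `ρ_k(T) = W_k⁻¹ (Id ⊗ T) W_k` of `T ∈ 𝓛_r(𝒳_k)`, where
`W_k⁻¹ : 𝒳_r(k) ⊗_B 𝒳_k → 𝒳` is `q ⊗ ξ ↦ q * inc X k ξ`: it is the unique operator that maps
`W_k⁻¹ (q ⊗ ξ)` to `W_k⁻¹ (q ⊗ T ξ)`. -/
noncomputable def rightRep (k : K) (T : (X k).rightOps) : Module.End ℂ (FreeProd X) :=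
  (existsUnique_rightRep k T).choose

theorem leftRep_apply (k : K) (T : (X k).leftOps) (ξ : (X k).Full) {q : FreeProd X}
    (hq : q ∈ notStart X k) :
    leftRep k T (inc X k ξ * q) = inc X k ((T : Module.End ℂ (X k).Full) ξ) * q :=
  (existsUnique_leftRep k T).choose_spec.1 ξ q hq

theorem rightRep_apply (k : K) (T : (X k).rightOps) (ξ : (X k).Full) {q : FreeProd X}
    (hq : q ∈ notEnd X k) :
    rightRep k T (q * inc X k ξ) = q * inc X k ((T : Module.End ℂ (X k).Full) ξ) :=
  (existsUnique_rightRep k T).choose_spec.1 ξ q hq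

end FreeProduct
/-! ### `B`-`B`-non-commutative probability spaces and bi-free independence -/

/-- The structure of a `B`-`B`-non-commutative probability space `(A, E, ε)` on a unital complex
algebra `A`. -/
structure BBSpace (B : Type u) [Ring B] [Algebra ℂ B] (A : Type v) [Ring A] [Algebra ℂ A] where
  ε : B ⊗[ℂ] Bᵐᵒᵖ →ₐ[ℂ] A
  E : A →ₗ[ℂ] B
  injective_left : Function.Injective fun b : B => ε (b ⊗ₜ 1)
  injective_right : Function.Injective fun b : B => ε (1 ⊗ₜ op b)
  E_bimodule : ∀ (b₁ b₂ : B) (T : A), E (ε (b₁ ⊗ₜ op b₂) * T) = b₁ * E T * b₂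
  E_balanced : ∀ (b : B) (T : A), E (T * ε (b ⊗ₜ 1)) = E (T * ε (1 ⊗ₜ op b))

section BBSpace

variable {B : Type u} [Ring B] [Algebra ℂ B] {A : Type v} [Ring A] [Algebra ℂ A] {K : Type w}

/-- `L_b = ε(b ⊗ 1)`. -/
def BBSpace.L (P : BBSpace B A) (b : B) : A := P.ε (b ⊗ₜ 1)

/-- `R_b = ε(1 ⊗ b)`. -/
def BBSpace.R (P : BBSpace B A) (b : B) : A := P.ε (1 ⊗ₜ op b)

/-- The left algebra `A_ℓ`: the elements that commute with all `R_b`. -/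
def BBSpace.leftAlg (P : BBSpace B A) : Subalgebra ℂ A :=
  Subalgebra.centralizer ℂ (Set.range P.R)

/-- The right algebra `A_r`: the elements that commute with all `L_b`. -/
def BBSpace.rightAlg (P : BBSpace B A) : Subalgebra ℂ A :=
  Subalgebra.centralizer ℂ (Set.range P.L)

/-- `(C, D)` is a pair of `B`-faces. -/
structure IsPairOfFaces (P : BBSpace B A) (C D : Subalgebra ℂ A) : Prop where
  left_mem : ∀ b, P.L b ∈ C
  left_le : C ≤ P.leftAlg
  right_mem : ∀ b, P.R b ∈ D
  right_le : D ≤ P.rightAlg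

/-- The element of `A` given by a letter, i.e. by an element of one of the faces. -/
def letter {C D : K → Subalgebra ℂ A} : (Σ k, C k ⊕ D k) → A
  | ⟨_, .inl c⟩ => c
  | ⟨_, .inr d⟩ => d

/-- The operator on the reduced free product given by a letter: `λ_k (ℓ_k c)` for `c ∈ C_k` and
`ρ_k (r_k d)` for `d ∈ D_k`. -/
noncomputable def letterOp {C D : K → Subalgebra ℂ A} {X : K → Bimod.{u, x} B}
    (l : ∀ k, C k →ₐ[ℂ] (X k).leftOps) (r : ∀ k, D k →ₐ[ℂ] (X k).rightOps) :
    (Σ k, C k ⊕ D k) → Module.End ℂ (FreeProd X)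
  | ⟨k, .inl c⟩ => leftRep k (l k c)
  | ⟨k, .inr d⟩ => rightRep k (r k d)

/-- The family `(C_k, D_k)` of pairs of `B`-faces is bi-free over `B`: there are bimodules with
specified `B`-projections `𝒳_k = B ⊕ X°_k` and unital homomorphisms `ℓ_k : C_k → 𝓛_ℓ(𝒳_k)` and
`r_k : D_k → 𝓛_r(𝒳_k)` such that the expectation of every word in elements of the faces is the
expectation of the corresponding word in the operators `λ_k (ℓ_k c)` and `ρ_k (r_k d)` on the
reduced free product of the `𝒳_k`. -/
def IsBiFree (P : BBSpace B A) (C D : K → Subalgebra ℂ A) : Prop :=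
  (∀ k, IsPairOfFaces P (C k) (D k)) ∧
  ∃ (X : K → Bimod.{u, x} B) (l : ∀ k, C k →ₐ[ℂ] (X k).leftOps)
    (r : ∀ k, D k →ₐ[ℂ] (X k).rightOps),
    ∀ word : List (Σ k, C k ⊕ D k),
      P.E (word.map letter).prod = freeProdE X (word.map (letterOp l r)).prod

/-- `{(Al k, Ar k, C' k, D' k)}` is a bi-free ffb `B`-system in `(A, E, ε)`; the algebras `C k` and
`D k` that contain the sets `C' k` and `D' k` need not be unital. Products of sets are the
elementwise ones. -/
structure IsBiFreeFFBSystem (P : BBSpace B A) (Al Ar : K → Subalgebra ℂ A) (C' D' : K → Set A) :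
    Prop where
  faces : ∀ k, IsPairOfFaces P (Al k) (Ar k)
  bifree : ∃ C D : K → NonUnitalSubalgebra ℂ A,
    IsBiFree.{u, v, w, x} P (fun k => Algebra.adjoin ℂ ((Al k : Set A) ∪ C k))
      (fun k => Algebra.adjoin ℂ ((Ar k : Set A) ∪ D k)) ∧
    ∀ k, C' k ⊆ C k ∧ D' k ⊆ (D k : Set A) ∩ P.leftAlg
  L_mul_mem : ∀ k b, ∀ c ∈ C' k, P.L b * c ∈ C' k
  mul_L_mem : ∀ k b, ∀ c ∈ C' k, c * P.L b ∈ C' k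
  C_mul_C : ∀ k, C' k * ((Al k ⊔ Ar k : Subalgebra ℂ A) : Set A) * C' k ⊆ {0}
  D_mul_D : ∀ k, D' k * ((Al k ⊔ Ar k : Subalgebra ℂ A) : Set A) * D' k ⊆ {0}
  E_C : ∀ (n : ℕ) (k : K), ∀ T ∈ ((Al k ⊔ Ar k : Subalgebra ℂ A) : Set A) * C' k *
    ((Al k ⊔ Ar k : Subalgebra ℂ A) : Set A) *
    (D' k * ((Al k ⊔ Ar k : Subalgebra ℂ A) : Set A) * C' k) ^ n *
    ((Al k ⊔ Ar k : Subalgebra ℂ A) : Set A), P.E T = 0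
  E_D : ∀ (n : ℕ) (k : K), ∀ T ∈ ((Al k ⊔ Ar k : Subalgebra ℂ A) : Set A) * D' k *
    ((Al k ⊔ Ar k : Subalgebra ℂ A) : Set A) *
    (C' k * ((Al k ⊔ Ar k : Subalgebra ℂ A) : Set A) * D' k) ^ n *
    ((Al k ⊔ Ar k : Subalgebra ℂ A) : Set A), P.E T = 0

end BBSpace

/-! ### Bi-non-crossing partitions and the operator-valued moments `E_π` -/

/-- The colours `ℓ` and `r`. -/
inductive Side
  | l
  | r
  deriving DecidableEq

section Partitions

variable {n : ℕ}

/-- A key that realises the order `≺_χ`: first the left indices in increasing order, then the right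
indices in decreasing order. -/
def chiKey (χ : Fin n → Side) (i : Fin n) : ℕ :=
  match χ i with
  | .l => i
  | .r => 2 * n - i

/-- The order `i ≺_χ j`. -/
def prec (χ : Fin n → Side) (i j : Fin n) : Prop := chiKey χ i < chiKey χ j

/-- The partition `π` (given by its equivalence relation `i ∼ j`) is bi-non-crossing with respect
to `χ`, i.e. non-crossing for the order `≺_χ`. -/
def IsBNC (χ : Fin n → Side) (π : Setoid (Fin n)) : Prop :=
  ∀ a₁ b₁ a₂ b₂ : Fin n, prec χ a₁ b₁ → prec χ b₁ a₂ → prec χ a₂ b₂ →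
    π a₁ a₂ → π b₁ b₂ → π a₁ b₁

open Classical in
/-- The minima of the blocks of `π` restricted to `S`. -/
noncomputable def blockMins (π : Setoid (Fin n)) (S : Finset (Fin n)) : Finset (Fin n) :=
  S.filter fun i => ∀ j ∈ S, π i j → i ≤ j

theorem blockMins_nonempty (π : Setoid (Fin n)) {S : Finset (Fin n)} (hS : S.Nonempty) :
    (blockMins π S).Nonempty :=
  ⟨S.min' hS, by
    classical
    exact Finset.mem_filter.2 ⟨S.min'_mem hS, fun j hj _ => S.min'_le j hj⟩⟩

/-- The largest among the minima of the blocks of `π` restricted to `S`. -/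
noncomputable def lastMin (π : Setoid (Fin n)) (S : Finset (Fin n)) (hS : S.Nonempty) : Fin n :=
  (blockMins π S).max' (blockMins_nonempty π hS)

open Classical in
/-- The block of `i` in `π` restricted to `S`. -/
noncomputable def block (π : Setoid (Fin n)) (S : Finset (Fin n)) (i : Fin n) : Finset (Fin n) :=
  S.filter fun j => π i j

open Classical in
theorem sdiff_block_card_lt (π : Setoid (Fin n)) (S : Finset (Fin n)) (hS : S.Nonempty) :
    (S \ block π S (lastMin π S hS)).card < S.card := by
  have h : lastMin π S hS ∈ S :=
    (Finset.mem_filter.1 ((blockMins π S).max'_mem (blockMins_nonempty π hS))).1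
  refine Finset.card_lt_card ((Finset.ssubset_iff_of_subset Finset.sdiff_subset).2
    ⟨lastMin π S hS, h, fun h' => (Finset.mem_sdiff.1 h').2 ?_⟩)
  exact Finset.mem_filter.2 ⟨h, π.refl _⟩

/-- Let `T` be the set of the remaining indices below the node `m` (those larger than `m` and
outside the block of `m`, all of which belong to blocks that also have an index smaller than `m`,
i.e. whose spines pass the level of `m`). The spines that pass this level are ordered from left to
right as their indices in `T` are ordered by `≺_χ`; hence the spine adjacent to `m` is that of the
`≺_χ`-least index of `T` when `m` is on the left, and of the `≺_χ`-greatest when `m` is on the right.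
This is that index. -/
noncomputable def adjacent (χ : Fin n → Side) (m : Fin n) (T : Finset (Fin n)) (hT : T.Nonempty) :
    Fin n :=
  match χ m with
  | .l => (Finset.exists_min_image T (chiKey χ) hT).choose
  | .r => (Finset.exists_max_image T (chiKey χ) hT).choose

end Partitions

section Moments

variable {B : Type u} [Ring B] [Algebra ℂ B] {A : Type v} [Ring A] [Algebra ℂ A] {n : ℕ}

/-- `E(∏_{i ∈ V} Z_i)`, the product being taken in increasing order of the indices. -/
noncomputable def blockE (P : BBSpace B A) (Z : Fin n → A) (V : Finset (Fin n)) : B :=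
  P.E ((V.sort (· ≤ ·)).map Z).prod

open Classical in
/-- The recursion that defines `E_{π|_S}((Z_1, …, Z_n)|_S)`, where `S` is a union of blocks of `π`.
With `V` the block in `S` that has the largest minimum `m`:
* if `V = S`, the value is `E(∏_{i ∈ S} Z_i)`;
* if all indices in `S \ V` are smaller than `m`, then `V` is removed and `Z_k` is replaced by
  `Z_k L_{E(V)}`, where `k = max (S \ V)`;
* otherwise `V` is removed and `Z_k` is replaced by `L_{E(V)} Z_k` or `R_{E(V)} Z_k`, according to
  the side of `m`, where `k` is the smallest index larger than `m` of the block `W` whose spine is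
  adjacent to `m`. -/
noncomputable def momentAux (P : BBSpace B A) (χ : Fin n → Side) (π : Setoid (Fin n))
    (Z : Fin n → A) (S : Finset (Fin n)) : B :=
  if hS : S.Nonempty then
    let m := lastMin π S hS
    let V := block π S m
    let b := blockE P Z V
    if hV : (S \ V).Nonempty then
      if hT : ((S \ V).filter (m < ·)).Nonempty then
        let j := adjacent χ m ((S \ V).filter (m < ·)) hT
        if hk : ((block π S j).filter (m < ·)).Nonempty then
          let k := ((block π S j).filter (m < ·)).min' hk
          match χ m with
          | .l => momentAux P χ π (Function.update Z k (P.L b * Z k)) (S \ V)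
          | .r => momentAux P χ π (Function.update Z k (P.R b * Z k)) (S \ V)
        else 0 -- never happens: `j` itself belongs to this set
      else
        let k := (S \ V).max' hV
        momentAux P χ π (Function.update Z k (Z k * P.L b)) (S \ V)
    else b
  else P.E 1
termination_by S.card
decreasing_by all_goals exact sdiff_block_card_lt π S hS

/-- The bi-multiplicative operator-valued moment `E_π(Z_1, …, Z_n)`. -/
noncomputable def moment (P : BBSpace B A) (χ : Fin n → Side) (π : Setoid (Fin n))
    (Z : Fin n → A) : B :=
  momentAux P χ π Z Finset.univ

end Moments

/-! ### The `ℓ`-`r`-replacement -/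

/-- The colours `ℓ`, `r` and `b`. -/
inductive Colour
  | l
  | r
  | b
  deriving DecidableEq

section Replacement

variable {n' : ℕ}

/-- The length `n = n' + |χ̂⁻¹(b)|` of the `ℓ`-`r`-replacement. -/
def lrLength (χ' : Fin n' → Colour) : ℕ := n' + (Finset.univ.filter fun j => χ' j = .b).card

/-- The number of indices before `i` of colour `b`. -/
def countB (χ' : Fin n' → Colour) (i : Fin n') : ℕ :=
  (Finset.univ.filter fun j => χ' j = .b ∧ j < i).card

theorem countB_le (χ' : Fin n' → Colour) (i : Fin n') :
    countB χ' i ≤ (Finset.univ.filter fun j => χ' j = .b).card :=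
  Finset.card_le_card fun j hj => by simp at hj ⊢; exact hj.1

theorem countB_lt (χ' : Fin n' → Colour) (i : Fin n') (hi : χ' i = .b) :
    countB χ' i < (Finset.univ.filter fun j => χ' j = .b).card :=
  Finset.card_lt_card ((Finset.ssubset_iff_of_subset
    fun j hj => by simp at hj ⊢; exact hj.1).2 ⟨i, by simp [hi], by simp⟩)

/-- The map `f(i) = i + |χ̂⁻¹(b) ∩ [1, i - 1]|`. -/
def lrPos (χ' : Fin n' → Colour) (i : Fin n') : Fin (lrLength χ') :=
  ⟨i + countB χ' i, by have := countB_le χ' i; have := i.2; unfold lrLength; omega⟩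

/-- The index `f(i) + 1`, for `i` of colour `b`. -/
def lrPosSucc (χ' : Fin n' → Colour) (i : Fin n') (hi : χ' i = .b) : Fin (lrLength χ') :=
  ⟨i + countB χ' i + 1, by have := countB_lt χ' i hi; have := i.2; unfold lrLength; omega⟩

open Classical in
/-- The `ℓ`-`r`-replacement of `χ̂`: the value at `f(j)` is `ℓ`, `r`, `ℓ` when `χ̂ j` is `ℓ`, `r`, `b`
respectively, and the value outside the range of `f` is `r`. -/
noncomputable def lrReplacement (χ' : Fin n' → Colour) (i : Fin (lrLength χ')) : Side :=
  if ∃ j, lrPos χ' j = i ∧ (χ' j = .l ∨ χ' j = .b) then .l else .r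

/-- Membership in `BNC_ffb(χ̂)`. -/
def IsBNCffb (χ' : Fin n' → Colour) (π : Setoid (Fin (lrLength χ'))) : Prop :=
  IsBNC (lrReplacement χ') π ∧
    ∀ (j : Fin n') (hj : χ' j = .b), π (lrPos χ' j) (lrPosSucc χ' j hj)

end Replacement

end BiFree

/-! Write `c j` and `d j` for the two nodes `f(j)` and `f(j) + 1` that replace an index of colour
`b`, and `M` for the algebra generated by the two faces. Suppose the moment is nonzero. Each step of
the recursion multiplies a remaining entry by `L_β` or `R_β`, where `β` is the expectation of the
removed block, so one vanishing block expectation kills the whole moment. The entries change on the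
way, but in a controlled manner (`IsAdapted`): at `c j` they stay in `M C'`, because factors on the
right are only of the form `L_b` and `C' L_b ⊆ C'`; at `d j` they stay in `M D' M`, and even in `D'
M` if `c j` is in the same block, because a factor on the left goes to the first node of its block
after the removed minimum, which is never such a `d j`. Hence every block has nonzero expectation
for some adapted entries (`momentAux_eq_zero_of_block`).

The axioms then restrict each block. As `C' M C' = 0` and `D' M D' = 0`, its nodes `c` and `d`
alternate. If it had a `d` but no `c`, its product would lie in `M D' M`, where `E` vanishes. If it
began and ended with a `c` (nodes with entries in `M` aside) and every `c k` strictly between two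
others were accompanied by `d k`, its product would lie in `M C' M (D' M C')^m M`, where `E`
vanishes as well.

What remains is combinatorial (`rel_c_d_of_noncrossing`). The order `≺_χ` lists the `c` increasingly
and then the `d` decreasingly. In a block that begins and ends with a `c`, some inner `c k` lacks
its `d k`; the block then has nodes `d` on both sides of `d k`, while the block of `d k` contains
some `c`, and the two cross. So no such block exists. For the least `j` with `c j` and `d j` in
different blocks, this yields `d e` in the block of `c j` and `c i` in the block of `d j` with `e, i
> j`, which is again a crossing. -/

namespace BiFree

/-! ### Products over index sets, split at an index -/

section OrderedProducts

variable {A : Type v} [Ring A] {n : ℕ}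

/-- The product `∏_{i ∈ V} Z_i` in increasing order of the indices. -/
noncomputable def orderedProd (Z : Fin n → A) (V : Finset (Fin n)) : A :=
  ((V.sort (· ≤ ·)).map Z).prod

theorem orderedProd_empty (Z : Fin n → A) : orderedProd Z ∅ = 1 := by
  simp [orderedProd]

theorem orderedProd_singleton (Z : Fin n → A) (a : Fin n) : orderedProd Z {a} = Z a := by
  simp [orderedProd]

theorem orderedProd_union (Z : Fin n → A) {V W : Finset (Fin n)} (h : ∀ a ∈ V, ∀ b ∈ W, a < b) :
    orderedProd Z (V ∪ W) = orderedProd Z V * orderedProd Z W := by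
  have hd : Disjoint V W := Finset.disjoint_left.2 fun a ha hb => lt_irrefl a (h a ha a hb)
  have key : (V ∪ W).sort (· ≤ ·) = V.sort (· ≤ ·) ++ W.sort (· ≤ ·) := by
    refine List.Perm.eq_of_pairwise' (r := (· ≤ ·)) (Finset.pairwise_sort _ _) ?_ ?_
    · rw [List.pairwise_append]
      exact ⟨Finset.pairwise_sort _ _, Finset.pairwise_sort _ _, fun a ha b hb =>
        (h a ((Finset.mem_sort _).1 ha) b ((Finset.mem_sort _).1 hb)).le⟩
    · refine (List.perm_ext_iff_of_nodup (Finset.sort_nodup _ _) ?_).2 fun a => by simp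
      rw [List.nodup_append']
      refine ⟨Finset.sort_nodup _ _, Finset.sort_nodup _ _, fun a ha hb => ?_⟩
      exact Finset.disjoint_left.1 hd ((Finset.mem_sort _).1 ha) ((Finset.mem_sort _).1 hb)
  simp [orderedProd, key]

theorem orderedProd_eq_filter_mul (Z : Fin n → A) (V : Finset (Fin n)) (a : Fin n) :
    orderedProd Z V = orderedProd Z (V.filter (· ≤ a)) * orderedProd Z (V.filter (a < ·)) := by
  rw [← orderedProd_union]
  · congr 1
    ext i
    have := le_or_gt i a
    simp only [Finset.mem_union, Finset.mem_filter]
    tauto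
  · intro i hi j hj
    exact (Finset.mem_filter.1 hi).2.trans_lt (Finset.mem_filter.1 hj).2

theorem orderedProd_filter_le (Z : Fin n → A) {V : Finset (Fin n)} {a : Fin n} (ha : a ∈ V) :
    orderedProd Z (V.filter (· ≤ a)) = orderedProd Z (V.filter (· < a)) * Z a := by
  rw [← orderedProd_singleton Z a, ← orderedProd_union]
  · congr 1
    ext i
    simp only [Finset.mem_union, Finset.mem_filter, Finset.mem_singleton, le_iff_lt_or_eq]
    constructor
    · rintro ⟨h, h' | h'⟩
      · exact Or.inl ⟨h, h'⟩
      · exact Or.inr h'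
    · rintro (h | rfl)
      · exact ⟨h.1, Or.inl h.2⟩
      · exact ⟨ha, Or.inr rfl⟩
  · intro i hi j hj
    rw [Finset.mem_singleton.1 hj]
    exact (Finset.mem_filter.1 hi).2

theorem orderedProd_eq_mul_mul (Z : Fin n → A) {V : Finset (Fin n)} {a : Fin n} (ha : a ∈ V) :
    orderedProd Z V =
      orderedProd Z (V.filter (· < a)) * Z a * orderedProd Z (V.filter (a < ·)) := by
  rw [orderedProd_eq_filter_mul Z V a, orderedProd_filter_le Z ha]

theorem orderedProd_mem [Algebra ℂ A] (M : Subalgebra ℂ A) {Z : Fin n → A} {V : Finset (Fin n)}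
    (h : ∀ i ∈ V, Z i ∈ M) : orderedProd Z V ∈ M := by
  refine Subalgebra.list_prod_mem M fun a ha => ?_
  obtain ⟨i, hi, rfl⟩ := List.mem_map.1 ha
  exact h i ((Finset.mem_sort _).1 hi)

theorem orderedProd_eq_zero {Z : Fin n → A} {V : Finset (Fin n)} {i : Fin n} (hi : i ∈ V)
    (h : Z i = 0) : orderedProd Z V = 0 := by
  rw [orderedProd_eq_mul_mul Z hi, h, mul_zero, zero_mul]

end OrderedProducts

/-! ### One step of the recursion for the moment -/

section Recursion

variable {B : Type u} [Ring B] [Algebra ℂ B] {A : Type v} [Ring A] [Algebra ℂ A] {n : ℕ}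

theorem blockE_eq (P : BBSpace B A) (Z : Fin n → A) (V : Finset (Fin n)) :
    blockE P Z V = P.E (orderedProd Z V) := rfl

theorem BBSpace.L_zero (P : BBSpace B A) : P.L 0 = 0 := by simp [BBSpace.L]

theorem BBSpace.R_zero (P : BBSpace B A) : P.R 0 = 0 := by simp [BBSpace.R]

theorem lastMin_mem (π : Setoid (Fin n)) (S : Finset (Fin n)) (hS : S.Nonempty) :
    lastMin π S hS ∈ S := by
  classical
  exact (Finset.mem_filter.1 ((blockMins π S).max'_mem (blockMins_nonempty π hS))).1

/-- One step of the recursion that defines `momentAux`. -/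
theorem momentAux_step (P : BBSpace B A) (χ : Fin n → Side) (π : Setoid (Fin n))
    (Z : Fin n → A) (S : Finset (Fin n)) (hS : S.Nonempty) :
    (S \ block π S (lastMin π S hS) = ∅ ∧
      momentAux P χ π Z S = blockE P Z (block π S (lastMin π S hS))) ∨
    momentAux P χ π Z S = 0 ∨
    (∃ k ∈ S \ block π S (lastMin π S hS), momentAux P χ π Z S =
      momentAux P χ π (Function.update Z k
        (Z k * P.L (blockE P Z (block π S (lastMin π S hS))))) (S \ block π S (lastMin π S hS))) ∨
    ∃ k ∈ S \ block π S (lastMin π S hS), lastMin π S hS < k ∧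
      (∀ i ∈ S, lastMin π S hS < i → π k i → k ≤ i) ∧
      ∃ y, (y = P.L (blockE P Z (block π S (lastMin π S hS))) ∨
          y = P.R (blockE P Z (block π S (lastMin π S hS)))) ∧
        momentAux P χ π Z S =
          momentAux P χ π (Function.update Z k (y * Z k)) (S \ block π S (lastMin π S hS)) := by
  classical
  rw [momentAux, dif_pos hS]
  dsimp only
  split_ifs with hV hT hk
  · right; right; right
    have hj : adjacent χ (lastMin π S hS) _ hT ∈
        (S \ block π S (lastMin π S hS)).filter (lastMin π S hS < ·) := by
      unfold adjacent
      split
      · exact (Finset.exists_min_image _ (chiKey χ) hT).choose_spec.1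
      · exact (Finset.exists_max_image _ (chiKey χ) hT).choose_spec.1
    set j := adjacent χ (lastMin π S hS) _ hT with hjdef
    have hkm := Finset.min'_mem _ hk
    set k := Finset.min' _ hk with hkdef
    simp only [block, Finset.mem_filter, Finset.mem_sdiff] at hj hkm
    -- Of the adjacent spine only this is kept: `k` is outside the removed block and is the first
    -- index after the removed minimum in its own block. Which block receives the factor plays no
    -- role.
    refine ⟨k, ?_, hkm.2, fun i hi hmi hki => ?_, ?_⟩
    · simp only [block, Finset.mem_filter, Finset.mem_sdiff]
      refine ⟨hkm.1.1, fun h => hj.1.2 ⟨hj.1.1, π.trans h.2 (π.symm hkm.1.2)⟩⟩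
    · refine Finset.min'_le _ _ ?_
      simp only [block, Finset.mem_filter]
      exact ⟨⟨hi, π.trans hkm.1.2 hki⟩, hmi⟩
    · cases χ (lastMin π S hS)
      · exact ⟨_, Or.inl rfl, rfl⟩
      · exact ⟨_, Or.inr rfl, rfl⟩
  -- The default branch has value `0`, which is harmless here, so that it is never reached need not
  -- be proved.
  · right; left; rfl
  · right; right; left
    exact ⟨_, Finset.max'_mem _ hV, rfl⟩
  · left
    exact ⟨Finset.not_nonempty_iff_eq_empty.1 hV, rfl⟩

/-- A zero entry stays zero under multiplication. When its block is removed the block expectation is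
`0`, and the factor `L_0 = R_0 = 0` creates a zero entry in a remaining block; this continues down
to the last block. -/
theorem momentAux_eq_zero_of_eq_zero (P : BBSpace B A) (χ : Fin n → Side) (π : Setoid (Fin n))
    (Z : Fin n → A) (S : Finset (Fin n)) {i : Fin n} (hi : i ∈ S) (h : Z i = 0) :
    momentAux P χ π Z S = 0 := by
  classical
  induction hc : S.card using Nat.strong_induction_on generalizing S Z i with
  | _ c ih =>
  subst hc
  have hS : S.Nonempty := ⟨i, hi⟩
  have hlt := sdiff_block_card_lt π S hS
  have hb : i ∈ block π S (lastMin π S hS) → blockE P Z (block π S (lastMin π S hS)) = 0 :=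
    fun hV => by rw [blockE_eq, orderedProd_eq_zero hV h, map_zero]
  rcases momentAux_step P χ π Z S hS with ⟨he, h1⟩ | h0 | ⟨k, hk, h1⟩ | ⟨k, hk, -, -, y, hy, h1⟩
  · rw [h1]
    refine hb ?_
    by_contra hV
    exact Finset.notMem_empty i (he ▸ Finset.mem_sdiff.2 ⟨hi, hV⟩)
  · exact h0
  · rw [h1]
    by_cases hV : i ∈ block π S (lastMin π S hS)
    · exact ih _ hlt _ _ hk (by simp [hb hV, P.L_zero]) rfl
    · refine ih _ hlt _ _ (Finset.mem_sdiff.2 ⟨hi, hV⟩) ?_ rfl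
      by_cases hki : i = k
      · subst hki; simp [h]
      · rw [Function.update_of_ne hki, h]
  · rw [h1]
    by_cases hV : i ∈ block π S (lastMin π S hS)
    · refine ih _ hlt _ _ hk ?_ rfl
      rcases hy with rfl | rfl <;> simp [hb hV, P.L_zero, P.R_zero]
    · refine ih _ hlt _ _ (Finset.mem_sdiff.2 ⟨hi, hV⟩) ?_ rfl
      by_cases hki : i = k
      · subst hki; simp [h]
      · rw [Function.update_of_ne hki, h]

end Recursion

/-! ### Entries that may occur during the recursion -/

section Adapted

variable {A : Type v} [Ring A] [Algebra ℂ A] {n : ℕ} {J : Type*}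

/-- The entries `Z_i`, `i ∈ V`, belong to the set prescribed by the kind of the index: those at the
indices `c j` are in `M C`, those at the indices `d j` are in `M D M`, and even in `D M` if `c j` is
in `V` too, and all others are in `M`. -/
structure IsAdapted (c d : J → Fin n) (M : Subalgebra ℂ A) (C D : Set A) (Z : Fin n → A)
    (V : Finset (Fin n)) : Prop where
  plain : ∀ i ∈ V, i ∉ Set.range c → i ∉ Set.range d → Z i ∈ M
  left : ∀ j, c j ∈ V → Z (c j) ∈ (M : Set A) * C
  right : ∀ j, d j ∈ V → Z (d j) ∈ (M : Set A) * D * M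
  mate : ∀ j, d j ∈ V → c j ∈ V → Z (d j) ∈ D * (M : Set A)

variable {c d : J → Fin n} {M : Subalgebra ℂ A} {C D : Set A} {Z : Fin n → A}
  {V : Finset (Fin n)}

/-- At a node `d` the new factor disappears into the final `M`. At a node `c` the set `M C` has no
algebra factor on the right, so `C` itself must absorb `y`. -/
theorem IsAdapted.update_mul (h : IsAdapted c d M C D Z V) (k : Fin n) {y : A} (hy : y ∈ M)
    (hC : ∀ t ∈ C, t * y ∈ C) : IsAdapted c d M C D (Function.update Z k (Z k * y)) V where
  plain i hi h1 h2 := by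
    have := h.plain i hi h1 h2
    rcases eq_or_ne i k with rfl | hik
    · simpa using M.mul_mem this hy
    · rwa [Function.update_of_ne hik]
  left j hj := by
    have := h.left j hj
    rcases eq_or_ne (c j) k with rfl | hik
    · obtain ⟨a, ha, t, ht, he⟩ := this
      simp only [Function.update_self, ← he, mul_assoc]
      exact Set.mul_mem_mul ha (hC t ht)
    · rwa [Function.update_of_ne hik]
  right j hj := by
    have := h.right j hj
    rcases eq_or_ne (d j) k with rfl | hik
    · obtain ⟨a, ha, t, ht, he⟩ := this
      simp only [Function.update_self, ← he, mul_assoc _ t]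
      exact Set.mul_mem_mul ha (M.mul_mem ht hy)
    · rwa [Function.update_of_ne hik]
  mate j hj hj' := by
    have := h.mate j hj hj'
    rcases eq_or_ne (d j) k with rfl | hik
    · obtain ⟨a, ha, t, ht, he⟩ := this
      simp only [Function.update_self, ← he, mul_assoc]
      exact Set.mul_mem_mul ha (M.mul_mem ht hy)
    · rwa [Function.update_of_ne hik]

/-- The new factor disappears into the initial `M`, except at a node `d j` with `c j` in the same
block: `D M` has no room on the left, and `hk` excludes this case. -/
theorem IsAdapted.update_mul_left (h : IsAdapted c d M C D Z V) (k : Fin n) {y : A} (hy : y ∈ M)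
    (hk : ∀ j, d j = k → c j ∈ V → d j ∉ V) :
    IsAdapted c d M C D (Function.update Z k (y * Z k)) V where
  plain i hi h1 h2 := by
    have := h.plain i hi h1 h2
    rcases eq_or_ne i k with rfl | hik
    · simpa using M.mul_mem hy this
    · rwa [Function.update_of_ne hik]
  left j hj := by
    have := h.left j hj
    rcases eq_or_ne (c j) k with rfl | hik
    · obtain ⟨a, ha, t, ht, he⟩ := this
      simp only [Function.update_self, ← he, ← mul_assoc]
      exact Set.mul_mem_mul (M.mul_mem hy ha) ht
    · rwa [Function.update_of_ne hik]
  right j hj := by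
    have := h.right j hj
    rcases eq_or_ne (d j) k with rfl | hik
    · obtain ⟨_, ⟨a, ha, s, hs, rfl⟩, t, ht, he⟩ := this
      simp only [Function.update_self, ← he, ← mul_assoc]
      exact Set.mul_mem_mul (Set.mul_mem_mul (M.mul_mem hy ha) hs) ht
    · rwa [Function.update_of_ne hik]
  mate j hj hj' := by
    rcases eq_or_ne (d j) k with hik | hik
    · exact absurd hj (hk j hik hj')
    · rw [Function.update_of_ne hik]
      exact h.mate j hj hj'

end Adapted

/-! ### A vanishing block expectation kills the moment -/

section Vanishing

variable {B : Type u} [Ring B] [Algebra ℂ B] {A : Type v} [Ring A] [Algebra ℂ A] {n : ℕ}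

/-- If the expectation of some block vanishes for all adapted entries, then so does the moment. -/
theorem momentAux_eq_zero_of_block (P : BBSpace B A) (χ : Fin n → Side) (π : Setoid (Fin n))
    {J : Type*} (c d : J → Fin n) (hcd : ∀ j, (d j : ℕ) = c j + 1)
    (M : Fin n → Subalgebra ℂ A) (C D : Fin n → Set A)
    (hL : ∀ i b, P.L b ∈ M i) (hR : ∀ i b, P.R b ∈ M i)
    (hCL : ∀ i b, ∀ t ∈ C i, t * P.L b ∈ C i) (i₀ : Fin n)
    (hbad : ∀ Z, IsAdapted c d (M i₀) (C i₀) (D i₀) Z (block π Finset.univ i₀) →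
      blockE P Z (block π Finset.univ i₀) = 0)
    (S : Finset (Fin n)) (hS : ∀ i ∈ S, ∀ j, π i j → j ∈ S) (hi₀ : i₀ ∈ S) (Z : Fin n → A)
    (hZ : ∀ i ∈ S, IsAdapted c d (M i) (C i) (D i) Z (block π Finset.univ i)) :
    momentAux P χ π Z S = 0 := by
  classical
  induction hc : S.card using Nat.strong_induction_on generalizing S Z with
  | _ c ih =>
  subst hc
  have hne : S.Nonempty := ⟨i₀, hi₀⟩
  have hlt := sdiff_block_card_lt π S hne
  have hm := lastMin_mem π S hne
  have hblock : ∀ i ∈ S, block π S i = block π Finset.univ i := by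
    intro i hi
    ext j
    simp only [block, Finset.mem_filter, Finset.mem_univ, true_and, and_iff_right_iff_imp]
    exact hS i hi j
  set m := lastMin π S hne with hmdef
  have hS' : ∀ i ∈ S \ block π S m, ∀ j, π i j → j ∈ S \ block π S m := by
    intro i hi j hij
    simp only [block, Finset.mem_sdiff, Finset.mem_filter] at hi ⊢
    exact ⟨hS i hi.1 j hij, fun h => hi.2 ⟨hi.1, π.trans h.2 (π.symm hij)⟩⟩
  -- When the turn of the block of `i₀` comes, its entries are still adapted, so `hbad` applies and
  -- the factor passed on is zero.
  have hb : i₀ ∈ block π S m → blockE P Z (block π S m) = 0 := by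
    intro h
    have h' : π m i₀ := (Finset.mem_filter.1 h).2
    have he : block π S m = block π Finset.univ i₀ := by
      rw [hblock m hm]
      ext j
      simp only [block, Finset.mem_filter, Finset.mem_univ, true_and]
      exact ⟨fun h => π.trans (π.symm h') h, fun h => π.trans h' h⟩
    rw [he]
    exact hbad Z (hZ i₀ hi₀)
  rcases momentAux_step P χ π Z S hne with
    ⟨he, h1⟩ | h0 | ⟨k, hk, h1⟩ | ⟨k, hk, hmk, hmin, y, hy, h1⟩
  · rw [h1]
    refine hb ?_
    by_contra hV
    exact Finset.notMem_empty i₀ (he ▸ Finset.mem_sdiff.2 ⟨hi₀, hV⟩)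
  · exact h0
  · rw [h1, ← hmdef]
    by_cases hV : i₀ ∈ block π S m
    · exact momentAux_eq_zero_of_eq_zero P χ π _ _ hk (by simp [hb hV, P.L_zero])
    · refine ih _ hlt _ hS' (Finset.mem_sdiff.2 ⟨hi₀, hV⟩) _ (fun i hi => ?_) rfl
      exact (hZ i (Finset.mem_sdiff.1 hi).1).update_mul k (hL i _) (hCL i _)
  · rw [h1]
    by_cases hV : i₀ ∈ block π S m
    · refine momentAux_eq_zero_of_eq_zero P χ π _ _ hk ?_
      rcases hy with rfl | rfl <;> simp [hb hV, ← hmdef, P.L_zero, P.R_zero]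
    · refine ih _ hlt _ hS' (Finset.mem_sdiff.2 ⟨hi₀, hV⟩) _ (fun i hi => ?_) rfl
      refine (hZ i (Finset.mem_sdiff.1 hi).1).update_mul_left k ?_ fun j hj h2 h3 => ?_
      · rcases hy with rfl | rfl
        exacts [hL i _, hR i _]
      -- The receiving index is not a `d j` with `c j` in its block: from `m < d j = c j + 1` and `m
      -- ≠ c j` follows `m < c j`, so `c j` would be an earlier index of that block after `m`.
      · subst hj
        simp only [block, Finset.mem_filter, Finset.mem_univ, true_and] at h2 h3
        have hdc : π (d j) (c j) := π.trans (π.symm h3) h2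
        have hcS : c j ∈ S \ block π S m := hS' _ hk _ hdc
        have hcm : c j ≠ m := by
          rintro h
          refine (Finset.mem_sdiff.1 hcS).2 ?_
          simp only [block, Finset.mem_filter]
          exact ⟨(Finset.mem_sdiff.1 hcS).1, by rw [h]⟩
        have hlt' : m < c j := by
          have h4 := hcd j
          have h5 : (m : ℕ) < d j := hmk
          have h6 : (c j : ℕ) ≠ m := fun h => hcm (Fin.ext h)
          exact Fin.lt_def.2 (by omega)
        have := hmin (c j) (Finset.mem_sdiff.1 hcS).1 hlt' hdc
        have h4 := hcd j
        have h5 : (d j : ℕ) ≤ c j := this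
        omega

end Vanishing

/-! ### Order relations between the paired nodes -/

/-- The `ℓ`-nodes `c j` and `r`-nodes `d j = c j + 1` that replace the nodes of colour `b`. -/
structure IsPairing {n : ℕ} {J : Type*} [LinearOrder J] (c d : J → Fin n) : Prop where
  succ : ∀ j, (d j : ℕ) = c j + 1
  lt : ∀ i j, i < j → d i < c j

namespace IsPairing

variable {n : ℕ} {J : Type*} [LinearOrder J] {c d : J → Fin n} (h : IsPairing c d)
include h

theorem c_lt_d_self (j : J) : c j < d j := Fin.lt_def.2 (by have := h.succ j; omega)

theorem d_lt_c_iff {i j : J} : d i < c j ↔ i < j := by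
  refine ⟨fun hij => ?_, h.lt i j⟩
  by_contra hn
  rcases (not_lt.1 hn).eq_or_lt with rfl | h'
  · exact lt_asymm hij (h.c_lt_d_self _)
  · exact lt_asymm hij (((h.c_lt_d_self j).trans (h.lt j i h')).trans (h.c_lt_d_self i))

theorem c_lt_d_iff {i j : J} : c i < d j ↔ i ≤ j := by
  constructor
  · intro hij
    by_contra hn
    exact lt_asymm hij (h.lt j i (not_le.1 hn))
  · intro hij
    rcases hij.eq_or_lt with rfl | h'
    · exact h.c_lt_d_self _
    · exact ((h.c_lt_d_self i).trans (h.lt i j h')).trans (h.c_lt_d_self j)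

theorem c_strictMono : StrictMono c := fun i j hij => (h.c_lt_d_self i).trans (h.lt i j hij)

theorem d_strictMono : StrictMono d := fun i j hij => (h.lt i j hij).trans (h.c_lt_d_self j)

end IsPairing

/-! ### The product over a single block -/

section Blocks

variable {A : Type v} [Ring A] {n : ℕ}

theorem orderedProd_filter_le_of_lt (Z : Fin n → A) {V : Finset (Fin n)} {a b : Fin n}
    (hb : b ∈ V) (hab : a < b) :
    orderedProd Z (V.filter (· ≤ b)) = orderedProd Z (V.filter (· ≤ a)) *
      (orderedProd Z (V.filter fun i => a < i ∧ i < b) * Z b) := by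
  have h1 : (V.filter (· < b)).filter (· ≤ a) = V.filter (· ≤ a) := by
    ext i
    simp only [Finset.mem_filter]
    exact ⟨fun h => ⟨h.1.1, h.2⟩, fun h => ⟨⟨h.1, h.2.trans_lt hab⟩, h.2⟩⟩
  have h2 : (V.filter (· < b)).filter (a < ·) = V.filter fun i => a < i ∧ i < b := by
    ext i
    simp only [Finset.mem_filter]
    tauto
  rw [orderedProd_filter_le Z hb, orderedProd_eq_filter_mul Z (V.filter (· < b)) a, mul_assoc,
    h1, h2]

theorem orderedProd_eq_zero_of_mul_mul {Z : Fin n → A} {V : Finset (Fin n)} {a b : Fin n}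
    (ha : a ∈ V) (hb : b ∈ V) (hab : a < b)
    (h : Z a * (orderedProd Z (V.filter fun i => a < i ∧ i < b) * Z b) = 0) :
    orderedProd Z V = 0 := by
  rw [orderedProd_eq_filter_mul Z V b, orderedProd_filter_le_of_lt Z hb hab,
    orderedProd_filter_le Z ha, mul_assoc _ (Z a), h, mul_zero, zero_mul]

variable [Algebra ℂ A] {J : Type*} [LinearOrder J] [Finite J] {c d : J → Fin n}
  {M : Subalgebra ℂ A} {C D : Set A} {Z : Fin n → A} {V : Finset (Fin n)}

omit [LinearOrder J] [Finite J] in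
theorem IsAdapted.orderedProd_mem (hZ : IsAdapted c d M C D Z V) {W : Finset (Fin n)}
    (hW : W ⊆ V) (hc : ∀ j, c j ∉ W) (hd : ∀ j, d j ∉ W) : orderedProd Z W ∈ M := by
  refine BiFree.orderedProd_mem M fun i hi => hZ.plain i (hW hi) ?_ ?_
  · rintro ⟨j, rfl⟩; exact hc j hi
  · rintro ⟨j, rfl⟩; exact hd j hi

/-- Otherwise `c j` and the next `c k` in `V` have only entries of `M` between them, and the product
contains a factor from `C M C = 0`. The bounds are asymmetric because `d i` comes after `c i`: it
lies between `c j` and `c j'` exactly when `j ≤ i < j'`. -/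
theorem exists_d_between (hp : IsPairing c d) (hZ : IsAdapted c d M C D Z V)
    (hCC : C * (M : Set A) * C ⊆ {0}) (h0 : orderedProd Z V ≠ 0) {j j' : J} (hj : c j ∈ V)
    (hj' : c j' ∈ V) (hjj' : j < j') : ∃ i, j ≤ i ∧ i < j' ∧ d i ∈ V := by
  by_contra! hno
  obtain ⟨k, ⟨hk, hjk⟩, hmin⟩ :=
    Set.exists_min_image {k | c k ∈ V ∧ j < k} id (Set.toFinite _) ⟨j', hj', hjj'⟩
  have hkj' : k ≤ j' := hmin j' ⟨hj', hjj'⟩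
  refine h0 (orderedProd_eq_zero_of_mul_mul hj hk (hp.c_strictMono hjk) ?_)
  have hmid : orderedProd Z (V.filter fun i => c j < i ∧ i < c k) ∈ M := by
    refine hZ.orderedProd_mem (Finset.filter_subset _ _) (fun i hi => ?_) (fun i hi => ?_)
    · simp only [Finset.mem_filter, hp.c_strictMono.lt_iff_lt] at hi
      exact not_le.2 hi.2.2 (hmin i ⟨hi.1, hi.2.1⟩)
    · simp only [Finset.mem_filter, hp.c_lt_d_iff, hp.d_lt_c_iff] at hi
      exact hno i hi.2.1 (hi.2.2.trans_le hkj') hi.1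
  obtain ⟨a, ha, t, ht, hat⟩ := hZ.left j hj
  obtain ⟨a', ha', t', ht', hat'⟩ := hZ.left k hk
  have := hCC (Set.mul_mem_mul (Set.mul_mem_mul ht (M.mul_mem hmid ha')) ht')
  rw [Set.mem_singleton_iff] at this
  simp only at hat hat'
  rw [← hat, ← hat', ← mul_assoc _ a' t', mul_assoc a t, ← mul_assoc t, this, mul_zero]

/-- The same argument with `D M D = 0`; the trailing and leading factors of `M D M` join the middle
part. Here `c i` lies between `d j` and `d j'` exactly when `j < i ≤ j'`. -/
theorem exists_c_between (hp : IsPairing c d) (hZ : IsAdapted c d M C D Z V)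
    (hDD : D * (M : Set A) * D ⊆ {0}) (h0 : orderedProd Z V ≠ 0) {j j' : J} (hj : d j ∈ V)
    (hj' : d j' ∈ V) (hjj' : j < j') : ∃ i, j < i ∧ i ≤ j' ∧ c i ∈ V := by
  by_contra! hno
  obtain ⟨k, ⟨hk, hjk⟩, hmin⟩ :=
    Set.exists_min_image {k | d k ∈ V ∧ j < k} id (Set.toFinite _) ⟨j', hj', hjj'⟩
  have hkj' : k ≤ j' := hmin j' ⟨hj', hjj'⟩
  refine h0 (orderedProd_eq_zero_of_mul_mul hj hk (hp.d_strictMono hjk) ?_)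
  have hmid : orderedProd Z (V.filter fun i => d j < i ∧ i < d k) ∈ M := by
    refine hZ.orderedProd_mem (Finset.filter_subset _ _) (fun i hi => ?_) (fun i hi => ?_)
    · simp only [Finset.mem_filter, hp.c_lt_d_iff, hp.d_lt_c_iff] at hi
      exact hno i hi.2.1 (hi.2.2.trans hkj') hi.1
    · simp only [Finset.mem_filter, hp.d_strictMono.lt_iff_lt] at hi
      exact not_le.2 hi.2.2 (hmin i ⟨hi.1, hi.2.1⟩)
  obtain ⟨_, ⟨a, ha, t, ht, rfl⟩, s, hs, hat⟩ := hZ.right j hj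
  obtain ⟨_, ⟨a', ha', t', ht', rfl⟩, s', hs', hat'⟩ := hZ.right k hk
  have := hDD (Set.mul_mem_mul (Set.mul_mem_mul ht (M.mul_mem hs (M.mul_mem hmid ha'))) ht')
  rw [Set.mem_singleton_iff] at this
  simp only at hat hat'
  rw [← hat, ← hat']
  calc a * t * s * (orderedProd Z (V.filter fun i => d j < i ∧ i < d k) * (a' * t' * s'))
      = a * (t * (s * (orderedProd Z (V.filter fun i => d j < i ∧ i < d k) * a')) * t') * s' := by
        simp only [mul_assoc]
    _ = 0 := by rw [this, mul_zero, zero_mul]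

/-- Two nodes `d` would have a node `c` between them, so `d j` is the only special node and all
other entries are in `M`. -/
theorem orderedProd_mem_of_d (hp : IsPairing c d) (hZ : IsAdapted c d M C D Z V)
    (hDD : D * (M : Set A) * D ⊆ {0}) (h0 : orderedProd Z V ≠ 0) {j : J} (hj : d j ∈ V)
    (hno : ∀ i, c i ∉ V) : orderedProd Z V ∈ (M : Set A) * D * M := by
  have hd : ∀ i, d i ∈ V → i = j := by
    intro i hi
    rcases lt_trichotomy i j with h | h | h
    · obtain ⟨k, -, -, hk⟩ := exists_c_between hp hZ hDD h0 hi hj h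
      exact absurd hk (hno k)
    · exact h
    · obtain ⟨k, -, -, hk⟩ := exists_c_between hp hZ hDD h0 hj hi h
      exact absurd hk (hno k)
  have h1 : orderedProd Z (V.filter (· < d j)) ∈ M := by
    refine hZ.orderedProd_mem (Finset.filter_subset _ _)
      (fun i hi => hno i (Finset.mem_filter.1 hi).1) fun i hi => ?_
    rw [Finset.mem_filter] at hi
    exact hi.2.ne (by rw [hd i hi.1])
  have h2 : orderedProd Z (V.filter (d j < ·)) ∈ M := by
    refine hZ.orderedProd_mem (Finset.filter_subset _ _)
      (fun i hi => hno i (Finset.mem_filter.1 hi).1) fun i hi => ?_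
    rw [Finset.mem_filter] at hi
    exact hi.2.ne (by rw [hd i hi.1])
  obtain ⟨_, ⟨a, ha, t, ht, rfl⟩, s, hs, hat⟩ := hZ.right j hj
  rw [orderedProd_eq_mul_mul Z hj, ← hat]
  refine ⟨_, Set.mul_mem_mul (M.mul_mem h1 ha) ht, _, M.mul_mem hs h2, ?_⟩
  simp only [mul_assoc]

/-- The product up to `c j` alternates between `C` and `D`. -/
theorem orderedProd_filter_le_mem (hp : IsPairing c d) (hZ : IsAdapted c d M C D Z V)
    (hCC : C * (M : Set A) * C ⊆ {0}) (hDD : D * (M : Set A) * D ⊆ {0}) (h0 : orderedProd Z V ≠ 0)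
    (hbefore : ∀ i, d i ∈ V → ∃ i' ≤ i, c i' ∈ V)
    (hmate : ∀ i j k, i < j → j < k → c i ∈ V → c j ∈ V → c k ∈ V → d j ∈ V)
    (j : J) (hj : c j ∈ V) :
    ∃ m : ℕ, orderedProd Z (V.filter (· ≤ c j)) ∈ (M : Set A) * C * M * (D * M * C) ^ m ∧
      ((∀ i < j, c i ∉ V) → m = 0) := by
  induction j using WellFoundedLT.induction with
  | _ j ih =>
  obtain ⟨b, hb, t, ht, hbt⟩ := hZ.left j hj
  simp only at hbt
  -- Before the first `c` there is no `d` either, by `hbefore`, so the preceding product is in `M`.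
  by_cases hfirst : ∀ i < j, c i ∉ V
  · refine ⟨0, ?_, fun _ => rfl⟩
    have h1 : orderedProd Z (V.filter (· < c j)) ∈ M := by
      refine hZ.orderedProd_mem (Finset.filter_subset _ _) (fun i hi => ?_) (fun i hi => ?_)
      · simp only [Finset.mem_filter, hp.c_strictMono.lt_iff_lt] at hi
        exact hfirst i hi.2 hi.1
      · simp only [Finset.mem_filter, hp.d_lt_c_iff] at hi
        obtain ⟨i', hi', hci'⟩ := hbefore i hi.1
        exact hfirst i' (hi'.trans_lt hi.2) hci'
    rw [orderedProd_filter_le Z hj, ← hbt, pow_zero, mul_one, ← mul_assoc]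
    exact ⟨_, Set.mul_mem_mul (M.mul_mem h1 hb) ht, 1, M.one_mem, mul_one _⟩
  · push Not at hfirst
    obtain ⟨i₀, hi₀, hci₀⟩ := hfirst
    obtain ⟨k, ⟨hkj, hk⟩, hmax⟩ :=
      Set.exists_max_image {k | k < j ∧ c k ∈ V} id (Set.toFinite _) ⟨i₀, hi₀, hci₀⟩
    have hnoc : ∀ i, k < i → i < j → c i ∉ V := fun i h1 h2 h3 => not_le.2 h1 (hmax i ⟨h2, h3⟩)
    -- With `c k` the previous `c` in `V`, alternation puts exactly one node `d i` between `c k` and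
    -- `c j`.
    obtain ⟨i, hki, hij, hi⟩ := exists_d_between hp hZ hCC h0 hk hj hkj
    have huniq : ∀ i', d i' ∈ V → k ≤ i' → i' < j → i' = i := by
      intro i' h1 h2 h3
      rcases lt_trichotomy i' i with h | h | h
      · obtain ⟨e, he1, he2, he⟩ := exists_c_between hp hZ hDD h0 h1 hi h
        exact absurd he (hnoc e (h2.trans_lt he1) (he2.trans_lt hij))
      · exact h
      · obtain ⟨e, he1, he2, he⟩ := exists_c_between hp hZ hDD h0 hi h1 h
        exact absurd he (hnoc e (hki.trans_lt he1) (he2.trans_lt h3))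
    obtain ⟨m, hm, hm0⟩ := ih k hkj hk
    have hmid1 : orderedProd Z (V.filter fun e => c k < e ∧ e < d i) ∈ M := by
      refine hZ.orderedProd_mem (Finset.filter_subset _ _) (fun e he => ?_) (fun e he => ?_)
      · simp only [Finset.mem_filter, hp.c_strictMono.lt_iff_lt, hp.c_lt_d_iff] at he
        exact hnoc e he.2.1 (he.2.2.trans_lt hij) he.1
      · simp only [Finset.mem_filter, hp.d_strictMono.lt_iff_lt, hp.c_lt_d_iff] at he
        exact he.2.2.ne (huniq e he.1 he.2.1 (he.2.2.trans hij))
    have hmid2 : orderedProd Z (V.filter fun e => d i < e ∧ e < c j) ∈ M := by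
      refine hZ.orderedProd_mem (Finset.filter_subset _ _) (fun e he => ?_) (fun e he => ?_)
      · simp only [Finset.mem_filter, hp.c_strictMono.lt_iff_lt, hp.d_lt_c_iff] at he
        exact hnoc e (hki.trans_lt he.2.1) he.2.2 he.1
      · simp only [Finset.mem_filter, hp.d_strictMono.lt_iff_lt, hp.d_lt_c_iff] at he
        exact he.2.1.ne' (huniq e he.1 (hki.trans he.2.1.le) he.2.2)
    refine ⟨m + 1, ?_, fun h => absurd hk (h k hkj)⟩
    rw [orderedProd_filter_le_of_lt Z hj (hp.lt i j hij),
      orderedProd_filter_le_of_lt Z hi (hp.c_lt_d_iff.2 hki), ← hbt, ← mul_assoc _ b t]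
    have hb' := M.mul_mem hmid2 hb
    -- The pattern `C M (D M C)^m` allows a factor of `M` after the first `C` but none between a
    -- later `C` and the following `D`. If `c k` is the first `c`, everything between `c k` and `d
    -- i` goes into that one `M`, and the exponent there is `0`.
    by_cases hkfirst : ∀ i < k, c i ∉ V
    · obtain rfl := hm0 hkfirst
      rw [pow_zero, mul_one] at hm
      obtain ⟨p, hp', a, ha, hpa⟩ := hm
      obtain ⟨_, ⟨a', ha', s, hs, rfl⟩, a'', ha'', hs'⟩ := hZ.right i hi
      simp only at hs' hpa
      rw [← hpa, ← hs', zero_add, pow_one]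
      refine ⟨_, Set.mul_mem_mul hp' (M.mul_mem ha (M.mul_mem hmid1 ha')), _,
        Set.mul_mem_mul (Set.mul_mem_mul hs (M.mul_mem ha'' hb')) ht, ?_⟩
      simp only [mul_assoc]
    · push Not at hkfirst
      obtain ⟨e, hek, he⟩ := hkfirst
      -- Otherwise `c k` has nodes `c` on both sides, so `hmate` gives `i = k`. Then `d k` follows
      -- `c k` immediately, and its entry is in `D M` without a factor on the left.
      have hdk : d k ∈ V := hmate e k j hek hkj he hk hj
      obtain rfl := huniq k hdk le_rfl hkj
      have hempty : (V.filter fun e => c k < e ∧ e < d k) = ∅ := by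
        refine Finset.filter_eq_empty_iff.2 fun e _ he => ?_
        have h1 := hp.succ k
        have h2 := Fin.lt_def.1 he.1
        have h3 := Fin.lt_def.1 he.2
        omega
      obtain ⟨s, hs, a'', ha'', hs'⟩ := hZ.mate k hi hk
      simp only at hs'
      rw [hempty, orderedProd_empty, one_mul, ← hs', pow_succ, ← mul_assoc]
      refine ⟨_, hm, _, Set.mul_mem_mul (Set.mul_mem_mul hs (M.mul_mem ha'' hb')) ht, ?_⟩
      simp only [mul_assoc]

/-- Cut after the last `c` of `V`: every `d` is followed by some `c`, so what remains is in `M`. -/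
theorem orderedProd_mem_of_c (hp : IsPairing c d) (hZ : IsAdapted c d M C D Z V)
    (hCC : C * (M : Set A) * C ⊆ {0}) (hDD : D * (M : Set A) * D ⊆ {0}) (h0 : orderedProd Z V ≠ 0)
    (hbefore : ∀ i, d i ∈ V → ∃ i' ≤ i, c i' ∈ V) (hafter : ∀ i, d i ∈ V → ∃ i' > i, c i' ∈ V)
    (hmate : ∀ i j k, i < j → j < k → c i ∈ V → c j ∈ V → c k ∈ V → d j ∈ V)
    (j : J) (hj : c j ∈ V) :
    ∃ m : ℕ, orderedProd Z V ∈ (M : Set A) * C * M * (D * M * C) ^ m * M := by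
  obtain ⟨k, hk, hmax⟩ := Set.exists_max_image {k | c k ∈ V} id (Set.toFinite _) ⟨j, hj⟩
  obtain ⟨m, hm, -⟩ := orderedProd_filter_le_mem hp hZ hCC hDD h0 hbefore hmate k hk
  refine ⟨m, ?_⟩
  rw [orderedProd_eq_filter_mul Z V (c k)]
  refine Set.mul_mem_mul hm (hZ.orderedProd_mem (Finset.filter_subset _ _) (fun i hi => ?_)
    (fun i hi => ?_))
  · simp only [Finset.mem_filter, hp.c_strictMono.lt_iff_lt] at hi
    exact not_le.2 hi.2 (hmax i hi.1)
  · simp only [Finset.mem_filter, hp.c_lt_d_iff] at hi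
    obtain ⟨i', hi', h⟩ := hafter i hi.1
    exact not_le.2 (hi.2.trans_lt hi') (hmax i' h)

end Blocks

/-! ### The combinatorial argument -/

section Matching

/-- If in every block the nodes `c` and `d` alternate, every node `d` has a node `c` in its block,
no block that starts and ends with a node `c` has all its inner nodes `c j` matched with `d j`, and
the partition is non-crossing, then `c j` and `d j` lie in the same block. -/
theorem rel_c_d_of_noncrossing {α J : Type*} [LinearOrder J] [Finite J] (π : Setoid α)
    (c d : J → α)
    (hcc : ∀ j j', j < j' → π (c j) (c j') → ∃ i, j ≤ i ∧ i < j' ∧ π (c j) (d i))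
    (hdd : ∀ j j', j < j' → π (d j) (d j') → ∃ i, j < i ∧ i ≤ j' ∧ π (d j) (c i))
    (hd : ∀ j, ∃ i, π (d j) (c i))
    (hodd : ∀ j, (∀ i, π (c j) (d i) → ∃ i' ≤ i, π (c j) (c i')) →
      (∀ i, π (c j) (d i) → ∃ i' > i, π (c j) (c i')) →
      ∃ i k l, i < k ∧ k < l ∧ π (c j) (c i) ∧ π (c j) (c k) ∧ π (c j) (c l) ∧ ¬ π (c j) (d k))
    (hnc1 : ∀ i i' e j, i < i' → j < e → π (c i) (d e) → π (c i') (d j) → π (c i) (c i'))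
    (hnc2 : ∀ i e j a, e < j → j < a → π (c i) (d j) → π (d a) (d e) → π (c i) (d a)) (j : J) :
    π (c j) (d j) := by
  -- No block begins and ends with a `c`. Alternation on both sides of the inner node `c k` gives `d
  -- e` and `d a` in the block with `e < k < a`, and the block of `d k` contains some `c f`, so `c f
  -- ≺ d a ≺ d k ≺ d e` would be a crossing.
  have hnot : ∀ j, ¬ ((∀ i, π (c j) (d i) → ∃ i' ≤ i, π (c j) (c i')) ∧
      ∀ i, π (c j) (d i) → ∃ i' > i, π (c j) (c i')) := by
    rintro j ⟨h1, h2⟩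
    obtain ⟨i, k, l, hik, hkl, hi, hk, hl, hdk⟩ := hodd j h1 h2
    obtain ⟨e, -, hek, he⟩ := hcc i k hik (π.trans (π.symm hi) hk)
    obtain ⟨a, hka, -, ha⟩ := hcc k l hkl (π.trans (π.symm hk) hl)
    replace he := π.trans hi he
    replace ha := π.trans hk ha
    have hka' : k < a := lt_of_le_of_ne hka fun h => hdk (h ▸ ha)
    obtain ⟨f, hf⟩ := hd k
    have := hnc2 f e k a hek hka' (π.symm hf) (π.trans (π.symm ha) he)
    exact hdk (π.trans (π.trans ha (π.symm this)) (π.symm hf))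
  induction j using WellFoundedLT.induction with
  | _ j ih =>
  by_contra hj
  -- If there were no such `e`, every `d i` in the block of `c j` would have `i < j`. It would be
  -- preceded by its mate `c i`, by induction, and followed by `c j`, contrary to `hnot`.
  obtain ⟨e, hje, he⟩ : ∃ e, j < e ∧ π (c j) (d e) := by
    by_contra! hno
    refine hnot j ⟨fun i hi => ?_, fun i hi => ⟨j, ?_, π.refl _⟩⟩
    · rcases le_or_gt j i with h | h
      · exact ⟨j, h, π.refl _⟩
      · exact ⟨i, le_rfl, π.trans hi (π.symm (ih i h))⟩
    · by_contra hi'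
      rcases (not_lt.1 hi').eq_or_lt with rfl | h
      · exact hj hi
      · exact hno i h hi
  obtain ⟨i, hi⟩ := hd j
  -- If `i < j`, take the largest `k < j` with `c k` in the block of `d j`. By induction `d k` is
  -- there too, and alternation between `d k` and `d j` gives a `c l` with `k < l ≤ j`, against
  -- maximality or against `hj`.
  have hji : j < i := by
    by_contra h
    have hij : i < j := lt_of_le_of_ne (not_lt.1 h) fun he => hj (he ▸ π.symm (he ▸ hi))
    obtain ⟨k, ⟨hkj, hk⟩, hmax⟩ :=
      Set.exists_max_image {k | k < j ∧ π (d j) (c k)} id (Set.toFinite _) ⟨i, hij, hi⟩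
    have hdk := π.trans hk (ih k hkj)
    obtain ⟨l, hkl, hlj, hl⟩ := hdd k j hkj (π.symm hdk)
    replace hl := π.trans hdk hl
    rcases hlj.eq_or_lt with rfl | hlj
    · exact hj (π.symm hl)
    · exact not_le.2 hkl (hmax l ⟨hlj, hl⟩)
  -- The crossing is `c j ≺ c i ≺ d e ≺ d j`.
  exact hj (π.trans (hnc1 j i e j hji hje he (π.symm hi)) (π.symm hi))

end Matching

/-! ### Positions in the `ℓ`-`r`-replacement -/

section Positions

variable {n' : ℕ} (χ' : Fin n' → Colour)

theorem countB_mono {i j : Fin n'} (h : i ≤ j) : countB χ' i ≤ countB χ' j :=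
  Finset.card_le_card fun k hk => by
    simp only [Finset.mem_filter] at hk ⊢
    exact ⟨hk.1, hk.2.1, hk.2.2.trans_le h⟩

theorem countB_succ_le {i j : Fin n'} (hi : χ' i = .b) (h : i < j) :
    countB χ' i + 1 ≤ countB χ' j := by
  refine Nat.succ_le_of_lt (Finset.card_lt_card ((Finset.ssubset_iff_of_subset fun k hk => ?_).2
    ⟨i, by simp [hi, h], by simp⟩))
  simp only [Finset.mem_filter] at hk ⊢
  exact ⟨hk.1, hk.2.1, hk.2.2.trans h⟩

theorem lrPos_strictMono : StrictMono (lrPos χ') := by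
  intro i j h
  have h1 := countB_mono χ' h.le
  have h2 : (i : ℕ) < j := h
  exact Fin.lt_def.2 (by simp only [lrPos]; omega)

theorem lrPosSucc_lt_lrPos {i j : Fin n'} (hi : χ' i = .b) (h : i < j) :
    lrPosSucc χ' i hi < lrPos χ' j := by
  have h1 := countB_succ_le χ' hi h
  have h2 : (i : ℕ) < j := h
  exact Fin.lt_def.2 (by simp only [lrPos, lrPosSucc]; omega)

theorem isPairing_lrPos : IsPairing (fun j : {j // χ' j = .b} => lrPos χ' j)
    (fun j => lrPosSucc χ' j j.2) where
  succ _ := rfl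
  lt i _ h := lrPosSucc_lt_lrPos χ' i.2 h

theorem lrPos_ne_lrPosSucc (j i : Fin n') (hi : χ' i = .b) : lrPos χ' j ≠ lrPosSucc χ' i hi := by
  intro h
  have hv := congrArg Fin.val h
  rcases lt_or_ge i j with h' | h'
  · exact (lrPosSucc_lt_lrPos χ' hi h').ne h.symm
  · have h1 := countB_mono χ' h'
    have h2 : (j : ℕ) ≤ i := h'
    simp only [lrPos, lrPosSucc] at hv
    omega

/-- By counting: both maps are injective with disjoint images, and `n' + |χ̂⁻¹(b)|` is the number of
all positions. -/
theorem exists_lrPos_or_lrPosSucc (i : Fin (lrLength χ')) :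
    (∃ j, lrPos χ' j = i) ∨ ∃ (j : Fin n') (hj : χ' j = .b), lrPosSucc χ' j hj = i := by
  classical
  let g : Fin n' ⊕ {j // χ' j = .b} → Fin (lrLength χ') :=
    Sum.elim (lrPos χ') fun j => lrPosSucc χ' j j.2
  have hinj : Function.Injective g := by
    refine Function.Injective.sumElim (lrPos_strictMono χ').injective
      (isPairing_lrPos χ').d_strictMono.injective fun a b => lrPos_ne_lrPosSucc χ' a b b.2
  have hcard : Fintype.card (Fin n' ⊕ {j // χ' j = .b}) = Fintype.card (Fin (lrLength χ')) := by
    rw [Fintype.card_sum, Fintype.card_fin, Fintype.card_fin, Fintype.card_subtype]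
    rfl
  obtain ⟨j | j, hj⟩ := ((Fintype.bijective_iff_injective_and_card g).2 ⟨hinj, hcard⟩).2 i
  · exact Or.inl ⟨j, hj⟩
  · exact Or.inr ⟨j, j.2, hj⟩

theorem chiKey_lrPos {j : Fin n'} (hj : χ' j = .b) :
    chiKey (lrReplacement χ') (lrPos χ' j) = lrPos χ' j := by
  have : lrReplacement χ' (lrPos χ' j) = .l := if_pos ⟨j, rfl, Or.inr hj⟩
  simp [chiKey, this]

theorem chiKey_lrPosSucc {j : Fin n'} (hj : χ' j = .b) :
    chiKey (lrReplacement χ') (lrPosSucc χ' j hj) = 2 * lrLength χ' - lrPosSucc χ' j hj := by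
  have : lrReplacement χ' (lrPosSucc χ' j hj) = .r :=
    if_neg fun ⟨i, hi, _⟩ => lrPos_ne_lrPosSucc χ' i j hj hi
  simp [chiKey, this]

end Positions

end BiFree

/-! ### Proof of the theorem -/

open BiFree in
theorem mainTheorem3 {B : Type u} [Ring B] [Algebra ℂ B] {A : Type v} [Ring A] [Algebra ℂ A]
    {K : Type w} (P : BBSpace B A) (Al Ar : K → Subalgebra ℂ A) (C' D' : K → Set A)
    (hsys : IsBiFreeFFBSystem.{u, v, w, x} P Al Ar C' D')
    {n' : ℕ} (χ' : Fin n' → Colour)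
    (ε : Fin (lrLength χ') → K)
    (hε : ∀ (j : Fin n') (hj : χ' j = .b), ε (lrPos χ' j) = ε (lrPosSucc χ' j hj))
    (Z : Fin (lrLength χ') → A)
    (hZl : ∀ j, χ' j = .l → Z (lrPos χ' j) ∈ Al (ε (lrPos χ' j)))
    (hZr : ∀ j, χ' j = .r → Z (lrPos χ' j) ∈ Ar (ε (lrPos χ' j)))
    (hZC : ∀ j, χ' j = .b → Z (lrPos χ' j) ∈ C' (ε (lrPos χ' j)))
    (hZD : ∀ i, i ∉ Set.range (lrPos χ') → Z i ∈ D' (ε i))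
    (π : Setoid (Fin (lrLength χ'))) (hπ : IsBNC (lrReplacement χ') π)
    (hπε : π ≤ Setoid.ker ε) (hffb : ¬ IsBNCffb χ' π) :
    moment P (lrReplacement χ') π Z = 0 := by
  by_contra hne
  refine hffb ⟨hπ, fun j hj => ?_⟩
  let c : {j // χ' j = .b} → Fin (lrLength χ') := fun j => lrPos χ' j
  let d : {j // χ' j = .b} → Fin (lrLength χ') := fun j => lrPosSucc χ' j j.2
  have hp : IsPairing c d := isPairing_lrPos χ'
  let M : K → Subalgebra ℂ A := fun k => Al k ⊔ Ar k
  have hker : ∀ {i j}, π i j → ε i = ε j := fun h => hπε h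
  have hmem : ∀ i j, j ∈ block π Finset.univ i ↔ π i j := fun i j => by simp [block]
  have hD : ∀ j, Z (d j) ∈ D' (ε (d j)) := fun j =>
    hZD _ fun ⟨i, hi⟩ => lrPos_ne_lrPosSucc χ' i j j.2 hi
  have hadapted : ∀ i, IsAdapted c d (M (ε i)) (C' (ε i)) (D' (ε i)) Z (block π Finset.univ i) := by
    intro i
    refine ⟨fun a ha h1 h2 => ?_, fun a ha => ?_, fun a ha => ?_, fun a ha _ => ?_⟩
    · rw [hker ((hmem _ _).1 ha)]
      rcases exists_lrPos_or_lrPosSucc χ' a with ⟨j, rfl⟩ | ⟨j, hj, rfl⟩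
      · match hc : χ' j with
        | .l => exact le_sup_left (a := Al _) (hZl j hc)
        | .r => exact le_sup_right (b := Ar _) (hZr j hc)
        | .b => exact absurd ⟨⟨j, hc⟩, rfl⟩ h1
      · exact absurd ⟨⟨j, hj⟩, rfl⟩ h2
    · rw [hker ((hmem _ _).1 ha)]
      exact ⟨1, (M _).one_mem, _, hZC a a.2, one_mul _⟩
    · rw [hker ((hmem _ _).1 ha)]
      exact ⟨_, ⟨1, (M _).one_mem, _, hD a, rfl⟩, 1, (M _).one_mem, by simp [d]⟩
    · rw [hker ((hmem _ _).1 ha)]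
      exact ⟨_, hD a, 1, (M _).one_mem, mul_one _⟩
  -- Nonvanishing of the moment yields, for each block separately, adapted entries with nonzero
  -- expectation. These need not be the original `Z`, and suffice because the block constraints
  -- concern `π` only.
  have hgood : ∀ i, ∃ Z', IsAdapted c d (M (ε i)) (C' (ε i)) (D' (ε i)) Z' (block π Finset.univ i) ∧
      blockE P Z' (block π Finset.univ i) ≠ 0 := by
    intro i
    by_contra! hbad
    refine hne (momentAux_eq_zero_of_block P (lrReplacement χ') π c d hp.succ (fun i => M (ε i))
      (fun i => C' (ε i)) (fun i => D' (ε i)) (fun i b => ?_) (fun i b => ?_) (fun i b => ?_) i hbad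
      Finset.univ (fun _ _ _ _ => Finset.mem_univ _) (Finset.mem_univ _) Z fun i _ => hadapted i)
    · exact le_sup_left (a := Al _) ((hsys.faces _).left_mem b)
    · exact le_sup_right (b := Ar _) ((hsys.faces _).right_mem b)
    · exact hsys.mul_L_mem _ b
  have hprod : ∀ {Z'} {V : Finset (Fin (lrLength χ'))}, blockE P Z' V ≠ 0 → orderedProd Z' V ≠ 0 :=
    fun h h0 => h (by rw [blockE_eq, h0, map_zero])
  refine rel_c_d_of_noncrossing π c d ?_ ?_ ?_ ?_ ?_ ?_ ⟨j, hj⟩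
  · intro i j hij h
    obtain ⟨Z', hZ', hE⟩ := hgood (c i)
    obtain ⟨k, h1, h2, h3⟩ := exists_d_between hp hZ' (hsys.C_mul_C _) (hprod hE)
      ((hmem _ _).2 (π.refl _)) ((hmem _ _).2 h) hij
    exact ⟨k, h1, h2, (hmem _ _).1 h3⟩
  · intro i j hij h
    obtain ⟨Z', hZ', hE⟩ := hgood (d i)
    obtain ⟨k, h1, h2, h3⟩ := exists_c_between hp hZ' (hsys.D_mul_D _) (hprod hE)
      ((hmem _ _).2 (π.refl _)) ((hmem _ _).2 h) hij
    exact ⟨k, h1, h2, (hmem _ _).1 h3⟩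
  -- A block with a `d` but no `c` is excluded by `E_D` with exponent `0`; the missing last factor
  -- of `M` is `1`.
  · intro i
    by_contra! hno
    obtain ⟨Z', hZ', hE⟩ := hgood (d i)
    have h := orderedProd_mem_of_d hp hZ' (hsys.D_mul_D _) (hprod hE) ((hmem _ _).2 (π.refl _))
      fun k hk => hno k ((hmem _ _).1 hk)
    refine hE (hsys.E_D 0 (ε (d i)) _ ?_)
    rw [pow_zero, mul_one]
    exact ⟨_, h, 1, (M _).one_mem, mul_one _⟩
  · intro i h1 h2
    by_contra! hno
    obtain ⟨Z', hZ', hE⟩ := hgood (c i)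
    obtain ⟨m, h⟩ := orderedProd_mem_of_c hp hZ' (hsys.C_mul_C _) (hsys.D_mul_D _) (hprod hE)
      (by simpa only [hmem] using h1) (by simpa only [hmem] using h2)
      (fun a b e hab hbe ha hb he => by
        rw [hmem] at *
        exact hno a b e hab hbe ha hb he) i ((hmem _ _).2 (π.refl _))
    exact hE (hsys.E_C m (ε (c i)) _ h)
  -- Keys of nodes `c` are below `n` and increase, keys of nodes `d` are above `n` and decrease, so
  -- `c i ≺ c i' ≺ d e ≺ d j`.
  · intro i i' e j hii' hje h1 h2
    refine hπ _ _ _ _ ?_ ?_ ?_ h1 h2 <;> unfold prec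
    · rw [chiKey_lrPos χ' i.2, chiKey_lrPos χ' i'.2]
      exact hp.c_strictMono hii'
    · rw [chiKey_lrPos χ' i'.2, chiKey_lrPosSucc χ' e.2]
      have := (c i').2
      have := (d e).2
      change (c i' : ℕ) < 2 * lrLength χ' - (d e : ℕ)
      omega
    · rw [chiKey_lrPosSucc χ' e.2, chiKey_lrPosSucc χ' j.2]
      have := Fin.lt_def.1 (hp.d_strictMono hje)
      have := (d e).2
      change 2 * lrLength χ' - (d e : ℕ) < 2 * lrLength χ' - (d j : ℕ)
      omega
  -- Here the order is `c i ≺ d a ≺ d j ≺ d e`.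
  · intro i e j a hej hja h1 h2
    refine hπ _ _ _ _ ?_ ?_ ?_ h1 h2 <;> unfold prec
    · rw [chiKey_lrPos χ' i.2, chiKey_lrPosSucc χ' a.2]
      have := (c i).2
      have := (d a).2
      change (c i : ℕ) < 2 * lrLength χ' - (d a : ℕ)
      omega
    · rw [chiKey_lrPosSucc χ' a.2, chiKey_lrPosSucc χ' j.2]
      have := Fin.lt_def.1 (hp.d_strictMono hja)
      have := (d a).2
      change 2 * lrLength χ' - (d a : ℕ) < 2 * lrLength χ' - (d j : ℕ)
      omega
    · rw [chiKey_lrPosSucc χ' j.2, chiKey_lrPosSucc χ' e.2]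
      have := Fin.lt_def.1 (hp.d_strictMono hej)
      have := (d j).2
      change 2 * lrLength χ' - (d j : ℕ) < 2 * lrLength χ' - (d e : ℕ)
      omega
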